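/- Let $\mathfrak T$ be a triangulated category with countable direct sums, and let $\mathfrak I$ be a stable homological ideal in $\mathfrak T$, that is, the kernel on morphisms of a homological functor to an abelian category with a suspension automorphism that commutes with the suspensions. Assume that $\mathfrak I$ is compatible with countable direct sums and has enough projective objects, and let $F\colon\mathfrak T\to\mathfrak A$ be the universal $\mathfrak I$-exact stable homological functor. Let $\langle\mathrm{Proj}_{\mathfrak I}\rangle\subseteq\mathfrak T$ be the localising subcategory generated by the $\mathfrak I$-projective objects. Assume that the stable abelian category $\mathfrak A$ is even, that is, $\mathfrak A=\mathfrak A_+\times\mathfrak A_-$ with $\mathfrak A_+[-1]=\mathfrak A_-$ and $\mathfrak A_-[-1]=\mathfrak A_+$, and that $\mathfrak A$ has global dimension (at most) $2$. A lifting of an object $A$ of $\mathfrak A$ is a pair $(\hat A,\alpha)$ with $\hat A$ in $\mathfrak T$ such that $\mathfrak T(\hat A,B)=0$ for all $\mathfrak I$-contractible $B$, and an isomorphism $\alpha\colon F(\hat A)\to A$. Given liftings $\hat A_1,\hat A_2$ of $A$, the relative obstruction class $\delta(\hat A_2,\hat A_1)\in\mathrm{Ext}^2(A,A[-1])$ is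 defined as follows. Choose an $\mathfrak I$-projective object $\hat P$ and an epimorphism $p\colon F(\hat P)\to A$, and write $\hat A_1$, $\hat A_2$ as the cones of morphisms $\varphi_1,\varphi_2\colon D\to\hat P$ such that $F(\varphi_1)=F(\varphi_2)$ and the maps $\hat P\to\hat A_i$ induce $p$, so that $F(D)\rightarrowtail F(\hat P)\twoheadrightarrow A$ is a short exact sequence. As $F(\varphi_2-\varphi_1)=0$, an exact triangle $\hat P[-1]\to E\to D\xrightarrow{\varphi_2-\varphi_1}\hat P$ gives an extension $F(\hat P)[-1]\rightarrowtail F(E)\twoheadrightarrow F(D)$. Its class in $\mathrm{Ext}^1(F(D),F(\hat P)[-1])$ is mapped to $\mathrm{Ext}^1(F(D),A[-1])$ by $p[-1]$ and then to $\mathrm{Ext}^2(A,A[-1])$ by the product with the class of $F(D)\rightarrowtail F(\hat P)\twoheadrightarrow A$. A canonical lifting of $A$ is a direct sum of liftings of $A_+$ and $A_-$, where $A\cong A_+\oplus A_-$ with $A_\pm$ in $\mathfrak A_\pm$. For $\hat A$ in $\langle\mathrm{Proj}_{\mathfrak I}\rangle$ let $\delta(\hat A):=\delta(\hat A,\hat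 A_0)\in\mathrm{Ext}^2(F(\hat A),F(\hat A)[-1])$, where $\hat A_0$ is a canonical lifting of $F(\hat A)$. Let $\mathfrak A\delta$ be the category of pairs $(A,\delta)$ with $A$ in $\mathfrak A$ and $\delta\in\mathrm{Ext}^2(A,A[-1])$, where morphisms $(A,\delta)\to(A',\delta')$ are the morphisms $f\colon A\to A'$ in $\mathfrak A$ with $\delta' f=f\delta$ in $\mathrm{Ext}^2(A,A'[-1])$. Then the class $\delta(\hat A)$ exists and is independent of all choices for each $\hat A$ in $\langle\mathrm{Proj}_{\mathfrak I}\rangle$, and $F\delta\colon\hat A\mapsto(F(\hat A),\delta(\hat A))$, $f\mapsto F(f)$, is a functor $\langle\mathrm{Proj}_{\mathfrak I}\rangle\to\mathfrak A\delta$. This functor is full and induces a bijection between isomorphism classes of objects in $\langle\mathrm{Proj}_{\mathfrak I}\rangle$ and isomorphism classes of objects in $\mathfrak A\delta$. Moreover, every morphism in $\langle\mathrm{Proj}_{\mathfrak I}\rangle$ that lifts an isomorphism in $\mathfrak A\delta$ is an isomorphism. -/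

import Mathlib

open CategoryTheory CategoryTheory.Limits CategoryTheory.Pretriangulated CategoryTheory.Abelian

universe w₁ w₂ w u v u' v'

namespace ExtEnriched

/-! ### Homological ideals and homological algebra relative to them -/

section Ideals

variable {T : Type u} [Category.{v} T] [HasZeroObject T] [HasShift T ℤ] [Preadditive T]
  [∀ n : ℤ, (shiftFunctor T n).Additive] [Pretriangulated T]

/-- A class of morphisms `J` of a triangulated category is a *stable homological ideal* if it is
the kernel on morphisms of a stable homological functor to a stable abelian category, that is,
of a homological functor commuting with the suspension, with values in an abelian category that
carries a suspension automorphism. -/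
def IsStableHomologicalIdeal (J : MorphismProperty T) : Prop :=
  ∃ (C : Type w₁) (_ : Category.{w₂} C) (_ : Abelian C) (_ : HasShift C ℤ)
    (_ : ∀ n : ℤ, (shiftFunctor C n).Additive)
    (H : T ⥤ C) (_ : H.CommShift ℤ) (_ : H.IsHomological),
    ∀ ⦃X Y : T⦄ (f : X ⟶ Y), J f ↔ H.map f = 0

/-- `J` is closed under direct sums of countable families of morphisms. -/
def CompatibleWithCountableSums [HasCountableCoproducts T] (J : MorphismProperty T) : Prop :=
  ∀ (ι : Type) [Countable ι] (X Y : ι → T) (f : ∀ i, X i ⟶ Y i),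
    (∀ i, J (f i)) → J (Limits.Sigma.map f)

/-- `P` is `J`-projective: the functor `T(P, -)` annihilates `J`. -/
def IsProj (J : MorphismProperty T) : ObjectProperty T := fun P =>
  ∀ ⦃X Y : T⦄ (f : X ⟶ Y), J f → ∀ g : P ⟶ X, g ≫ f = 0

/-- `B` is `J`-contractible: its identity morphism belongs to `J`. -/
def IsContractible (J : MorphismProperty T) : ObjectProperty T := fun B => J (𝟙 B)

/-- `p : X ⟶ Y` is `J`-epic: in an exact triangle `X ⟶ Y ⟶ Z ⟶ X⟦1⟧` starting with `p`, the
morphism `Y ⟶ Z` belongs to `J`. -/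
def IsEpic (J : MorphismProperty T) {X Y : T} (p : X ⟶ Y) : Prop :=
  ∃ (Z : T) (q : Y ⟶ Z) (r : Z ⟶ X⟦(1 : ℤ)⟧), Triangle.mk p q r ∈ distTriang T ∧ J q

/-- `J` has enough projective objects. -/
def EnoughProj (J : MorphismProperty T) : Prop :=
  ∀ X : T, ∃ (P : T) (p : P ⟶ X), IsProj J P ∧ IsEpic J p

/-- The localising subcategory generated by the `J`-projective objects: the intersection of all
strictly full triangulated subcategories that are closed under countable direct sums and contain
all `J`-projective objects. -/
def Loc (J : MorphismProperty T) : ObjectProperty T := fun X =>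
  ∀ Q : ObjectProperty T, Q.IsClosedUnderIsomorphisms → Q.IsTriangulated →
    (∀ (ι : Type) [Countable ι], Q.IsClosedUnderColimitsOfShape (Discrete ι)) →
    IsProj J ≤ Q → Q X

/-- There is no nonzero morphism from `X` to a `J`-contractible object. -/
def IsOrth (J : MorphismProperty T) : ObjectProperty T := fun X =>
  ∀ ⦃B : T⦄, IsContractible J B → ∀ f : X ⟶ B, f = 0

variable {A : Type u'} [Category.{v'} A] [Abelian A] [HasShift A ℤ]
  [∀ n : ℤ, (shiftFunctor A n).Additive]

/-- `F` (a stable homological functor to a stable abelian category) is the *universal* `J`-exact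
stable homological functor: it is `J`-exact, and every `J`-exact stable homological functor to a
stable abelian category factors through `F` by a stable exact functor, which is unique up to
natural isomorphism. -/
structure IsUniversal (J : MorphismProperty T) (F : T ⥤ A) [F.CommShift ℤ] [F.IsHomological] :
    Prop where
  map_eq_zero : ∀ ⦃X Y : T⦄ (f : X ⟶ Y), J f → F.map f = 0
  factors : ∀ (C : Type (w + 1)) [Category.{w} C] [Abelian C] [HasShift C ℤ]
    [∀ n : ℤ, (shiftFunctor C n).Additive] (H : T ⥤ C) [H.CommShift ℤ] [H.IsHomological],
    (∀ ⦃X Y : T⦄ (f : X ⟶ Y), J f → H.map f = 0) →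
    ∃ (G : A ⥤ C) (_ : G.CommShift ℤ) (_ : PreservesFiniteLimits G)
      (_ : PreservesFiniteColimits G) (e : F ⋙ G ≅ H), NatTrans.CommShift e.hom ℤ
  unique : ∀ (C : Type (w + 1)) [Category.{w} C] [Abelian C] [HasShift C ℤ]
    [∀ n : ℤ, (shiftFunctor C n).Additive] (G G' : A ⥤ C) [G.CommShift ℤ] [G'.CommShift ℤ]
    [PreservesFiniteLimits G] [PreservesFiniteColimits G]
    [PreservesFiniteLimits G'] [PreservesFiniteColimits G'] (e : F ⋙ G ≅ F ⋙ G'),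
    NatTrans.CommShift e.hom ℤ → Nonempty (G ≅ G')

end Ideals

/-! ### Even stable abelian categories -/

section Even

variable (A : Type u') [Category.{v'} A] [Abelian A] [HasShift A ℤ]

/-- A decomposition `A = A₊ × A₋` of a stable abelian category, given by two strictly full
subcategories, with `A₊[-1] = A₋` and `A₋[-1] = A₊`. -/
structure EvenDecomposition where
  pos : ObjectProperty A
  neg : ObjectProperty A
  pos_iso : pos.IsClosedUnderIsomorphisms
  neg_iso : neg.IsClosedUnderIsomorphisms
  pos_neg : ∀ ⦃X Y : A⦄, pos X → neg Y → ∀ f : X ⟶ Y, f = 0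
  neg_pos : ∀ ⦃X Y : A⦄, neg X → pos Y → ∀ f : X ⟶ Y, f = 0
  decomp : ∀ X : A, ∃ X₀ X₁ : A, pos X₀ ∧ neg X₁ ∧ Nonempty (X ≅ X₀ ⊞ X₁)
  shift_pos : ∀ X : A, pos X ↔ neg (X⟦(-1 : ℤ)⟧)
  shift_neg : ∀ X : A, neg X ↔ pos (X⟦(-1 : ℤ)⟧)

end Even

/-! ### Liftings and obstruction classes -/

section Liftings

variable {T : Type u} [Category.{v} T] [HasZeroObject T] [HasShift T ℤ] [Preadditive T]
  [∀ n : ℤ, (shiftFunctor T n).Additive] [Pretriangulated T]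
  {A : Type u'} [Category.{v'} A] [Abelian A] [HasShift A ℤ]
  [∀ n : ℤ, (shiftFunctor A n).Additive]
  (J : MorphismProperty T) (F : T ⥤ A) [F.CommShift ℤ] [F.IsHomological]

/-- A lifting of `M`. -/
structure Lifting (M : A) where
  obj : T
  orth : IsOrth J obj
  iso : F.obj obj ≅ M

variable [HasExt.{w} A]

/-- For `f : D ⟶ B` with `F(f) = 0`, the class in `Ext¹(F(D), F(B)[-1])` that corresponds to `f`
in the Universal Coefficient Theorem: complete `f` to an exact triangle
`B[-1] ⟶ E ⟶ D ⟶ B`, and take the class of the extension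
`F(B)[-1] ≅ F(B[-1]) ⟶ F(E) ⟶ F(D)`. -/
def IsUCTClass {D B : T} (f : D ⟶ B) (x : Ext.{w} (F.obj D) ((F.obj B)⟦(-1 : ℤ)⟧) 1) : Prop :=
  ∃ (E : T) (a : B⟦(-1 : ℤ)⟧ ⟶ E) (b : E ⟶ D) (c : D ⟶ B⟦(-1 : ℤ)⟧⟦(1 : ℤ)⟧),
    Triangle.mk a b c ∈ distTriang T ∧
    c ≫ (shiftFunctorCompIsoId T (-1 : ℤ) 1 (by norm_num)).hom.app B = f ∧
    ∃ (h0 : F.map a ≫ F.map b = 0)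
      (hS : (ShortComplex.mk (F.map a) (F.map b) h0).ShortExact),
      x = hS.extClass.comp (Ext.mk₀ ((F.commShiftIso (-1 : ℤ)).hom.app B)) (add_zero 1)

variable {J F}

/-- `e` is the relative obstruction class `δ(L₂, L₁)` of two liftings of `M`.
Here `P` is the lifting of a projective object `F(P)`, `p : F(P) ⟶ M` is an epimorphism with
kernel `F(D)`, and the liftings `L₁`, `L₂` are the cones of morphisms `φ₁, φ₂ : D ⟶ P`
that induce the same inclusion `F(D) ⟶ F(P)`. The class of `φ₂ - φ₁` in
`Ext¹(F(D), F(P)[-1])` is mapped to `Ext¹(F(D), M[-1])` by `p` and to `Ext²(M, M[-1])` by the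
extension `F(D) ⟶ F(P) ⟶ M`. -/
def IsRelObstructionClass {M : A} (L₂ L₁ : Lifting J F M)
    (e : Ext.{w} M (M⟦(-1 : ℤ)⟧) 2) : Prop :=
  ∃ (P D : T) (p : F.obj P ⟶ M) (φ₁ φ₂ : D ⟶ P)
    (π₁ : P ⟶ L₁.obj) (κ₁ : L₁.obj ⟶ D⟦(1 : ℤ)⟧)
    (π₂ : P ⟶ L₂.obj) (κ₂ : L₂.obj ⟶ D⟦(1 : ℤ)⟧),
    IsProj J P ∧
    Triangle.mk φ₁ π₁ κ₁ ∈ distTriang T ∧ Triangle.mk φ₂ π₂ κ₂ ∈ distTriang T ∧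
    F.map π₁ ≫ L₁.iso.hom = p ∧ F.map π₂ ≫ L₂.iso.hom = p ∧
    F.map φ₁ = F.map φ₂ ∧
    ∃ (h0 : F.map φ₁ ≫ p = 0)
      (hS : (ShortComplex.mk (F.map φ₁) p h0).ShortExact)
      (x : Ext.{w} (F.obj D) ((F.obj P)⟦(-1 : ℤ)⟧) 1),
      IsUCTClass F (φ₂ - φ₁) x ∧
      e = hS.extClass.comp (x.comp (Ext.mk₀ (p⟦(-1 : ℤ)⟧')) (add_zero 1)) one_add_one_eq_two

/-- `L` is a canonical lifting of `M`: there is a decomposition `M ≅ M₀ ⊞ M₁` into an even and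
an odd object such that `L` is the direct sum of a lifting of `M₀` and a lifting of `M₁`. -/
def IsCanonical (dec : EvenDecomposition A) {M : A} (L : Lifting J F M) : Prop :=
  ∃ (M₀ M₁ : A) (_ : dec.pos M₀) (_ : dec.neg M₁) (b : M ≅ M₀ ⊞ M₁)
    (L₀ : Lifting J F M₀) (L₁ : Lifting J F M₁) (s : L.obj ≅ L₀.obj ⊞ L₁.obj),
    L.iso.hom ≫ b.hom ≫ biprod.fst = F.map (s.hom ≫ biprod.fst) ≫ L₀.iso.hom ∧
    L.iso.hom ≫ b.hom ≫ biprod.snd = F.map (s.hom ≫ biprod.snd) ≫ L₁.iso.hom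

/-- `e` is the obstruction class `δ(X)` of `X`: the obstruction class of `X`, viewed as a
lifting of `F(X)`, relative to a canonical lifting of `F(X)`. -/
def IsObstructionClass (J : MorphismProperty T) (F : T ⥤ A) [F.CommShift ℤ] [F.IsHomological]
    (dec : EvenDecomposition A) (X : T)
    (e : Ext.{w} (F.obj X) ((F.obj X)⟦(-1 : ℤ)⟧) 2) : Prop :=
  ∃ (h : IsOrth J X) (L₀ : Lifting J F (F.obj X)), IsCanonical dec L₀ ∧
    IsRelObstructionClass ⟨X, h, Iso.refl _⟩ L₀ e

end Liftings

/-! ### The category of pairs -/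

section Pairs

variable (A : Type u') [Category.{v'} A] [Abelian A] [HasShift A ℤ] [HasExt.{w} A]

/-- Pairs `(M, δ)` with `δ ∈ Ext²(M, M[-1])`. -/
structure Pairs where
  obj : A
  cls : Ext.{w} obj (obj⟦(-1 : ℤ)⟧) 2

variable {A}

/-- Compatibility of `f : M ⟶ M'` with classes `δ` and `δ'`: the equation `δ' f = f δ` in
`Ext²(M, M'[-1])`. -/
def Compatible {M M' : A} (δ : Ext.{w} M (M⟦(-1 : ℤ)⟧) 2) (δ' : Ext.{w} M' (M'⟦(-1 : ℤ)⟧) 2)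
    (f : M ⟶ M') : Prop :=
  (Ext.mk₀ f).comp δ' (zero_add 2) = δ.comp (Ext.mk₀ (f⟦(-1 : ℤ)⟧')) (add_zero 2)

/-- Morphisms of pairs. -/
@[ext]
structure Pairs.Hom (X Y : Pairs.{w} A) where
  hom : X.obj ⟶ Y.obj
  compatible : Compatible X.cls Y.cls hom

instance : Category (Pairs.{w} A) where
  Hom := Pairs.Hom
  id X := ⟨𝟙 X.obj, by simp [Compatible]⟩
  comp {X Y Z} f g := ⟨f.hom ≫ g.hom, by
    have hf := f.compatible
    have hg := g.compatible
    unfold Compatible at hf hg ⊢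
    rw [Functor.map_comp, ← Ext.mk₀_comp_mk₀, ← Ext.mk₀_comp_mk₀,
      Ext.comp_assoc_of_second_deg_zero, hg, ← Ext.comp_assoc_of_third_deg_zero, hf,
      Ext.comp_assoc_of_third_deg_zero]⟩

variable {T : Type u} [Category.{v} T]

/-- The functor `X ↦ (F(X), δ(X))` on a full subcategory, for classes `δ(X)` with which the
morphisms `F(f)` are compatible. -/
def pairFunctor (Q : ObjectProperty T) (F : T ⥤ A)
    (δ : ∀ X : Q.FullSubcategory, Ext.{w} (F.obj X.obj) ((F.obj X.obj)⟦(-1 : ℤ)⟧) 2)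
    (hδ : ∀ (X Y : Q.FullSubcategory) (f : X ⟶ Y),
      Compatible (δ X) (δ Y) ((Q.ι ⋙ F).map f)) :
    Q.FullSubcategory ⥤ Pairs.{w} A where
  obj X := ⟨F.obj X.obj, δ X⟩
  map {X Y} f := ⟨(Q.ι ⋙ F).map f, hδ X Y f⟩
  map_id X := Pairs.Hom.ext ((Q.ι ⋙ F).map_id X)
  map_comp f g := Pairs.Hom.ext ((Q.ι ⋙ F).map_comp f g)

end Pairs

/-- The map induced by a functor on isomorphism classes of objects. -/
def isoClassMap {C : Type u} [Category.{v} C] {D : Type u'} [Category.{v'} D] (G : C ⥤ D) :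
    Quotient (isIsomorphicSetoid C) → Quotient (isIsomorphicSetoid D) :=
  Quotient.map G.obj fun _ _ h => h.map G.mapIso

end ExtEnriched

/-!
The proof is obstruction theory for the surjectivity of `T(X, Y) ⟶ Hom(F(X), F(Y))`.

*What universality provides.* Only four properties of the universal functor matter, collected in
`IsProjectiveApproximation`: it vanishes exactly on `J`, it is full on morphisms out of relative
projective objects, it maps these to projective objects, and these images cover everything. They
hold by `IsUniversal.isProjectiveApproximation`. For the proof, `F` is compared with the Yoneda
functor `projYoneda` to finitely presented presheaves on the relative projective objects, for which
the analogous facts are the Yoneda Lemma. By universality the Yoneda functor factors through `F`,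
and conversely `F` factors through it by a right exact extension (`extFunctor`), which is exact
because `F` maps weak kernels of relative projective objects to exact sequences. The uniqueness in
the universal property shows that `G ⋙ extFunctor _ ≅ 𝟭 A`, where `G` is the first factorization.
Suspensions are dealt with by cofree stable functors (`cofree`), which turn any homological functor
into a stable one.

*The localising subcategory.* Countable coproducts split idempotents, so all projective objects of
the target lift to relative projective ones (`exists_isProj_iso`). With finite global dimension,
`⟨Proj⟩` therefore consists of the objects without morphisms to contractible objects
(`loc_iff_isOrth`), and `F` reflects isomorphisms between these (`isIso_of_isIso_map`).

*Obstructions.* If `F(D)` has projective dimension at most one, there is a Universal Coefficient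
Theorem: `T(D, B) ⟶ Hom(F(D), F(B))` is surjective with kernel `Ext¹(F(D), F(B)[-1])`
(`exists_lift`, `eq_zero_of_isUCTClass_zero`, `exists_of_ext`). In global dimension two it applies
to the fibre `D` of a cover `P ⟶ X`. It attaches to `q : F(X) ⟶ F(Y)` a class `o(q)` in
`Ext²(F(X), F(Y)[-1])`, described by `IsLiftObstruction`, which vanishes exactly if `q` lifts to
`T(X, Y)`, and which is a derivation: `o(q' q) = q' o(q) + o(q') q` (`IsLiftObstruction.comp`). The
relative obstruction class of two liftings is the obstruction to lifting the identity
(`IsRelObstructionClass.comp_eq`).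

*Parity.* Since `Extⁿ` vanishes between even and odd objects (`EvenDecomposition.ext_eq_zero`), every
morphism between canonical liftings lifts (`IsParitySum.exists_lift`). The derivation property then
gives `o(q) = q δ(X) - δ(Y) q` for every `q : F(X) ⟶ F(Y)`
(`IsObstructionClass.liftObstruction_add`). Lifting the identity of `F(X)` shows that `δ(X)` is well
defined; the vanishing of `o(F(f))` is functoriality; and the fact that `q` lifts if
`o(q) = 0` is fullness. Finally, every class `δ` in `Ext²(M, M[-1])` occurs
(`exists_isObstructionClass_iso`): if a canonical lifting of `M` is the cone of `φ : D ⟶ P`, then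
`δ` comes from a class in `Ext¹(F(D), F(P)[-1])`, which is the class of some `u : D ⟶ P`, and the
cone of `φ + u` is a lifting of `M` with obstruction class `δ`.
-/

set_option linter.unusedSectionVars false

namespace ExtEnriched

/-! ### Graded objects and the cofree stable functor -/

section Graded

variable (B : Type*) [Category B]

/-- Translation of the index set `ℤ` of graded objects by `a`. -/
abbrev translate (a : ℤ) : Discrete ℤ ⥤ Discrete ℤ :=
  Discrete.functor fun i => ⟨a + i⟩

/-- The shift of graded objects: `(K⟦a⟧) i = K (a + i)`. -/
@[reducible] noncomputable def gradedShift : HasShift (Discrete ℤ ⥤ B) ℤ :=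
  hasShiftMk (Discrete ℤ ⥤ B) ℤ
    { F := fun a => (Functor.whiskeringLeft _ _ B).obj (translate a)
      zero := NatIso.ofComponents (fun K => Discrete.natIso fun i =>
        K.mapIso (Discrete.eqToIso (by simp [translate])))
        (by intros; ext; simp [translate])
      add := fun a b => NatIso.ofComponents (fun K => Discrete.natIso fun i =>
        K.mapIso (Discrete.eqToIso (by simp [translate, add_assoc])))
        (by intros; ext; simp [translate])
      assoc_hom_app := by
        intro a b c K
        ext i
        simp [eqToHom_map]
      zero_add_hom_app := by
        intro a K
        ext i
        simp [eqToHom_map]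
      add_zero_hom_app := by
        intro a K
        ext i
        simp [eqToHom_map] }

attribute [local instance] gradedShift

variable {B}

lemma gradedShift_zero_inv_app_app (K : Discrete ℤ ⥤ B) (i : ℤ) :
    ((shiftFunctorZero (Discrete ℤ ⥤ B) ℤ).inv.app K).app ⟨i⟩ =
      K.map (eqToHom (by simp)) := rfl

lemma gradedShift_add_inv_app_app (K : Discrete ℤ ⥤ B) (a b i : ℤ) :
    ((shiftFunctorAdd (Discrete ℤ ⥤ B) a b).inv.app K).app ⟨i⟩ =
      K.map (eqToHom (by simp [add_assoc])) := rfl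

variable {T : Type*} [Category T] [HasShift T ℤ]

/-- The cofree stable functor on a functor `H`: it maps `X` to the graded object with
components `H (X⟦i⟧)`. -/
def cofree (H : T ⥤ B) : T ⥤ Discrete ℤ ⥤ B where
  obj X := Discrete.functor fun i => H.obj (X⟦i⟧)
  map f := Discrete.natTrans fun i => H.map (f⟦i.as⟧')
  map_id X := by ext; simp
  map_comp f g := by ext; simp

lemma cofree_obj_map_eqToHom (H : T ⥤ B) (X : T) {i j : ℤ} (h : i = j) :
    ((cofree H).obj X).map (eqToHom (congrArg Discrete.mk h)) =
      H.map (eqToHom (by rw [h])) := by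
  subst h
  simp
  rfl

noncomputable instance cofreeCommShift (H : T ⥤ B) : (cofree H).CommShift ℤ where
  commShiftIso a := NatIso.ofComponents (fun X => Discrete.natIso fun i =>
      H.mapIso ((shiftFunctorAdd T a i.as).symm.app X))
    (by
      intro X Y f
      ext ⟨i⟩
      change H.map ((f⟦a⟧')⟦i⟧') ≫ H.map ((shiftFunctorAdd T a i).inv.app Y) =
        H.map ((shiftFunctorAdd T a i).inv.app X) ≫ H.map (f⟦a + i⟧')
      rw [← H.map_comp, ← H.map_comp]
      congr 1
      exact (shiftFunctorAdd T a i).inv.naturality f)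
  commShiftIso_zero := by
    ext X ⟨i⟩
    rw [Functor.CommShift.isoZero_hom_app, NatTrans.comp_app, gradedShift_zero_inv_app_app]
    change H.map ((shiftFunctorAdd T 0 i).inv.app X) =
      H.map (((shiftFunctorZero T ℤ).hom.app X)⟦i⟧') ≫ _
    have h : i = 0 + i := by simp
    erw [cofree_obj_map_eqToHom H X h]
    rw [shiftFunctorAdd_zero_add_inv_app, H.map_comp]
  commShiftIso_add := by
    intro a b
    ext X ⟨i⟩
    rw [Functor.CommShift.isoAdd_hom_app]
    simp only [NatTrans.comp_app, gradedShift_add_inv_app_app]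
    change H.map ((shiftFunctorAdd T (a + b) i).inv.app X) =
      H.map (((shiftFunctorAdd T a b).hom.app X)⟦i⟧') ≫
        H.map ((shiftFunctorAdd T b i).inv.app (X⟦a⟧)) ≫
          H.map ((shiftFunctorAdd T a (b + i)).inv.app X) ≫ _
    have h : a + (b + i) = a + b + i := by simp [add_assoc]
    erw [cofree_obj_map_eqToHom H X h]
    simp only [← H.map_comp]
    congr 1
    have h₁ := shiftFunctorAdd_assoc_inv_app (C := T) a b i X
    have h₂ : (shiftFunctorAdd' T a (b + i) (a + b + i) (add_assoc _ _ _).symm).inv.app X =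
        (shiftFunctorAdd T a (b + i)).inv.app X ≫ eqToHom (by rw [h]) := by
      simp [shiftFunctorAdd']
    rw [h₂] at h₁
    rw [← h₁, ← Functor.map_comp_assoc]
    simp

instance gradedShift_additive [Preadditive B] (a : ℤ) :
    (shiftFunctor (Discrete ℤ ⥤ B) a).Additive where
  map_add := by intros; rfl

/-- The degree zero part of the cofree stable functor on `H` is `H`. -/
noncomputable def cofreeCompEval (H : T ⥤ B) :
    cofree H ⋙ (evaluation (Discrete ℤ) B).obj ⟨0⟩ ≅ H :=
  NatIso.ofComponents (fun X => H.mapIso ((shiftFunctorZero T ℤ).app X)) (by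
    intro X Y f
    change H.map (f⟦(0 : ℤ)⟧') ≫ H.map _ = H.map _ ≫ H.map f
    rw [← H.map_comp, ← H.map_comp]
    congr 1
    exact (shiftFunctorZero T ℤ).hom.naturality f)

lemma cofree_preservesFiniteLimits [Abelian B] (Q : T ⥤ B) [PreservesFiniteLimits Q] :
    PreservesFiniteLimits (cofree Q) :=
  preservesFiniteLimits_of_evaluation _ fun i =>
    inferInstanceAs (PreservesFiniteLimits (shiftFunctor T i.as ⋙ Q))

lemma cofree_preservesFiniteColimits [Abelian B] (Q : T ⥤ B) [PreservesFiniteColimits Q] :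
    PreservesFiniteColimits (cofree Q) :=
  preservesFiniteColimits_of_evaluation _ fun i =>
    inferInstanceAs (PreservesFiniteColimits (shiftFunctor T i.as ⋙ Q))

section

variable {A : Type*} [Category A] [HasShift A ℤ] (F : T ⥤ A) [F.CommShift ℤ]

/-- An isomorphism `F ⋙ Q ≅ F ⋙ Q'` with `F` stable induces an isomorphism of the
composites of `F` with the cofree stable functors on `Q` and `Q'`. -/
noncomputable def cofreeIso {Q Q' : A ⥤ B} (e : F ⋙ Q ≅ F ⋙ Q') :
    F ⋙ cofree Q ≅ F ⋙ cofree Q' :=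
  NatIso.ofComponents (fun X => Discrete.natIso fun i =>
      Q.mapIso ((F.commShiftIso i.as).symm.app X) ≪≫ e.app (X⟦i.as⟧) ≪≫
        Q'.mapIso ((F.commShiftIso i.as).app X))
    (by
      intro X Y f
      ext ⟨i⟩
      change Q.map ((F.map f)⟦i⟧') ≫ Q.map ((F.commShiftIso i).inv.app Y) ≫
          e.hom.app (Y⟦i⟧) ≫ Q'.map ((F.commShiftIso i).hom.app Y) =
        (Q.map ((F.commShiftIso i).inv.app X) ≫
          e.hom.app (X⟦i⟧) ≫ Q'.map ((F.commShiftIso i).hom.app X)) ≫ Q'.map ((F.map f)⟦i⟧')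
      have h := e.hom.naturality (f⟦i⟧')
      dsimp at h
      rw [← Q.map_comp_assoc, F.commShiftIso_inv_naturality, Q.map_comp_assoc, reassoc_of% h,
        ← Q'.map_comp, F.commShiftIso_hom_naturality, Q'.map_comp]
      simp)

instance cofreeIso_commShift {Q Q' : A ⥤ B} (e : F ⋙ Q ≅ F ⋙ Q') :
    NatTrans.CommShift (cofreeIso F e).hom ℤ where
  shift_comm a := by
    ext X ⟨i⟩
    simp only [NatTrans.comp_app, Functor.commShiftIso_comp_hom_app]
    change (Q.map (((F.commShiftIso a).hom.app X)⟦i⟧') ≫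
        Q.map ((shiftFunctorAdd A a i).inv.app (F.obj X))) ≫
        (Q.map ((F.commShiftIso (a + i)).inv.app X) ≫
          e.hom.app (X⟦a + i⟧) ≫ Q'.map ((F.commShiftIso (a + i)).hom.app X)) =
      (Q.map ((F.commShiftIso i).inv.app (X⟦a⟧)) ≫
          e.hom.app (X⟦a⟧⟦i⟧) ≫ Q'.map ((F.commShiftIso i).hom.app (X⟦a⟧))) ≫
        Q'.map (((F.commShiftIso a).hom.app X)⟦i⟧') ≫
        Q'.map ((shiftFunctorAdd A a i).inv.app (F.obj X))
    have h := e.hom.naturality ((shiftFunctorAdd T a i).hom.app X)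
    dsimp at h
    have hadd := F.commShiftIso_add a i
    rw [hadd, Functor.CommShift.isoAdd_hom_app, Functor.CommShift.isoAdd_inv_app]
    simp only [Functor.map_comp, Category.assoc]
    rw [← reassoc_of% h]
    rw [← Q.map_comp_assoc ((shiftFunctorAdd A a i).inv.app _), Iso.inv_hom_id_app, Q.map_id,
      Category.id_comp, ← Q.map_comp_assoc ((shiftFunctor A i).map _), ← Functor.map_comp,
      Iso.hom_inv_id_app, CategoryTheory.Functor.map_id, Q.map_id, Category.id_comp,
      ← Q.map_comp_assoc (F.map ((shiftFunctorAdd T a i).inv.app X)), ← F.map_comp,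
      Iso.inv_hom_id_app, F.map_id, Q.map_id, Category.id_comp]

end

end Graded

/-- Exactness in functor categories is detected pointwise. -/
lemma exact_of_evaluation {K B : Type*} [Category K] [Category B] [Abelian B]
    (S : ShortComplex (K ⥤ B))
    (hS : ∀ k : K, (S.map ((evaluation K B).obj k)).Exact) : S.Exact := by
  rw [ShortComplex.exact_iff_isZero_homology, Functor.isZero_iff]
  intro k
  exact ((ShortComplex.exact_iff_isZero_homology _).1 (hS k)).of_iso
    (S.mapHomologyIso ((evaluation K B).obj k)).symm

section Nonstable

variable {T : Type u} [Category.{v} T] [HasZeroObject T] [HasShift T ℤ] [Preadditive T]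
  [∀ n : ℤ, (shiftFunctor T n).Additive] [Pretriangulated T]

attribute [local instance] gradedShift

lemma cofree_isHomological {B : Type*} [Category B] [Abelian B] (H : T ⥤ B) [H.IsHomological] :
    (cofree H).IsHomological where
  map_zero X Y := by
    ext ⟨i⟩
    change H.map ((0 : X ⟶ Y)⟦i⟧') = 0
    simp
  exact t ht := exact_of_evaluation _ fun ⟨i⟩ => by
    let := Functor.ShiftSequence.tautological H ℤ
    exact H.homologySequence_exact₂ t ht i

lemma IsStableHomologicalIdeal.shift {J : MorphismProperty T}
    (hJ : IsStableHomologicalIdeal.{w₁, w₂} J) {X Y : T} {f : X ⟶ Y} (hf : J f) (n : ℤ) :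
    J (f⟦n⟧') := by
  obtain ⟨C, _, _, _, _, H, _, _, h⟩ := hJ
  rw [h] at hf ⊢
  have := H.commShiftIso_hom_naturality f n
  rw [hf, Functor.map_zero, comp_zero] at this
  exact (cancel_mono _).1 (this.trans zero_comp.symm)

variable {A : Type u'} [Category.{v'} A] [Abelian A] [HasShift A ℤ]
  [∀ n : ℤ, (shiftFunctor A n).Additive]
  {J : MorphismProperty T} {F : T ⥤ A} [F.CommShift ℤ] [F.IsHomological]

omit [∀ n : ℤ, (shiftFunctor A n).Additive] in
/-- Universality without suspensions: any homological functor `H` that annihilates the ideal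
factors through an exact functor, namely the degree zero part of the stable exact functor through
which the cofree stable functor on `H` factors. -/
lemma IsUniversal.exists_exact_factorization (hJ : IsStableHomologicalIdeal.{w₁, w₂} J)
    (hF : IsUniversal.{w} J F) {B : Type (w + 1)} [Category.{w} B] [Abelian B] (H : T ⥤ B)
    [H.IsHomological] (hH : ∀ ⦃X Y : T⦄ (f : X ⟶ Y), J f → H.map f = 0) :
    ∃ (G : A ⥤ B) (_ : PreservesFiniteLimits G) (_ : PreservesFiniteColimits G),
      Nonempty (F ⋙ G ≅ H) := by
  have := cofree_isHomological H
  obtain ⟨G, _, _, _, e, _⟩ := hF.factors (Discrete ℤ ⥤ B) (cofree H) (by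
    intro X Y f hf
    ext ⟨i⟩
    exact hH _ (hJ.shift hf i))
  exact ⟨G ⋙ (evaluation (Discrete ℤ) B).obj ⟨0⟩, inferInstance, inferInstance,
    ⟨(Functor.associator _ _ _).symm ≪≫ Functor.isoWhiskerRight e _ ≪≫ cofreeCompEval H⟩⟩

omit [∀ n : ℤ, (shiftFunctor A n).Additive] in
/-- The uniqueness that belongs to `IsUniversal.exists_exact_factorization`, by the same passage to
cofree stable functors. -/
lemma IsUniversal.nonempty_iso (hF : IsUniversal.{w} J F) {B : Type (w + 1)} [Category.{w} B]
    [Abelian B] (G G' : A ⥤ B) [PreservesFiniteLimits G] [PreservesFiniteColimits G]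
    [PreservesFiniteLimits G'] [PreservesFiniteColimits G'] (e : F ⋙ G ≅ F ⋙ G') :
    Nonempty (G ≅ G') := by
  have := cofree_preservesFiniteLimits G
  have := cofree_preservesFiniteLimits G'
  have := cofree_preservesFiniteColimits G
  have := cofree_preservesFiniteColimits G'
  obtain ⟨i⟩ := hF.unique (Discrete ℤ ⥤ B) (cofree G) (cofree G') (cofreeIso F e) inferInstance
  exact ⟨(cofreeCompEval G).symm ≪≫ Functor.isoWhiskerRight i _ ≪≫ cofreeCompEval G'⟩

end Nonstable
/-! ### Finitely presented presheaves on a preadditive category with weak kernels -/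

section Presheaves

variable {K : Type u} [Category.{v} K]

/-- The action of a morphism `r : R ⟶ P` on an element of a presheaf of abelian groups. -/
def act (N : Kᵒᵖ ⥤ AddCommGrpCat.{w}) {R P : K} (r : R ⟶ P) (n : N.obj (.op P)) :
    N.obj (.op R) := N.map r.op n

variable (N N' : Kᵒᵖ ⥤ AddCommGrpCat.{w})

@[simp] lemma act_id {P : K} (n : N.obj (.op P)) : act N (𝟙 P) n = n := by simp [act]

lemma act_comp {P Q R : K} (r : R ⟶ Q) (s : Q ⟶ P) (n : N.obj (.op P)) :
    act N (r ≫ s) n = act N r (act N s n) := by simp [act]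

@[simp] lemma act_zero {P R : K} (r : R ⟶ P) : act N r 0 = 0 := map_zero _

variable {N N'}

lemma app_act (f : N ⟶ N') {P R : K} (r : R ⟶ P) (n : N.obj (.op P)) :
    f.app (.op R) (act N r n) = act N' r (f.app (.op P) n) :=
  ConcreteCategory.congr_hom (f.naturality r.op) n

variable [Preadditive K]

/-- The element `n` of `N` exhibits the presheaf `N` as the cokernel of the morphism of
representable presheaves induced by `d : Q ⟶ P`. Presheaves are not required to be additive
functors; additivity of the action on the generator is part of the notion and implies it. -/
structure IsPresentation (N : Kᵒᵖ ⥤ AddCommGrpCat.{w}) {Q P : K} (d : Q ⟶ P)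
    (n : N.obj (.op P)) : Prop where
  gen : ∀ ⦃R : K⦄ (x : N.obj (.op R)), ∃ r : R ⟶ P, act N r n = x
  rel : ∀ ⦃R : K⦄ (r : R ⟶ P), act N r n = 0 ↔ ∃ s : R ⟶ Q, s ≫ d = r
  add : ∀ ⦃R : K⦄ (r r' : R ⟶ P), act N (r + r') n = act N r n + act N r' n

lemma IsPresentation.sub {Q P : K} {d : Q ⟶ P} {n : N.obj (.op P)} (h : IsPresentation N d n)
    {R : K} (r r' : R ⟶ P) : act N (r - r') n = act N r n - act N r' n := by
  rw [eq_sub_iff_add_eq, ← h.add, sub_add_cancel]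

lemma IsPresentation.act_d {Q P : K} {d : Q ⟶ P} {n : N.obj (.op P)} (h : IsPresentation N d n) :
    act N d n = 0 := (h.rel d).2 ⟨𝟙 Q, by simp⟩

/-- Finitely presented presheaves with values in abelian groups. -/
def finPres (K : Type u) [Category.{v} K] [Preadditive K] :
    ObjectProperty (Kᵒᵖ ⥤ AddCommGrpCat.{w}) := fun N =>
  ∃ (Q P : K) (d : Q ⟶ P) (n : N.obj (.op P)), IsPresentation N d n

/-- A weak pullback of `a` and `b` is obtained from a weak kernel of the difference of the two
composites `P ⊞ Q ⟶ S`. -/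
lemma exists_weakPullback [HasBinaryBiproducts K] [HasWeakKernels K] {P Q S : K}
    (a : P ⟶ S) (b : Q ⟶ S) :
    ∃ (W : K) (x : W ⟶ P) (y : W ⟶ Q), x ≫ a = y ≫ b ∧
      ∀ {R : K} (r : R ⟶ P) (s : R ⟶ Q), r ≫ a = s ≫ b → ∃ t : R ⟶ W, t ≫ x = r ∧ t ≫ y = s := by
  let k : P ⊞ Q ⟶ S := biprod.fst ≫ a - biprod.snd ≫ b
  refine ⟨weakKernel k, weakKernel.ι k ≫ biprod.fst, weakKernel.ι k ≫ biprod.snd, ?_,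
    fun r s hrs => ⟨weakKernel.lift k (biprod.lift r s) (by simp [k, hrs]), ?_, ?_⟩⟩
  · rw [Category.assoc, Category.assoc, ← sub_eq_zero, ← Preadditive.comp_sub]
    exact weakKernel.condition k
  · rw [← Category.assoc, weakKernel.lift_ι, biprod.lift_fst]
  · rw [← Category.assoc, weakKernel.lift_ι, biprod.lift_snd]

/-- A kernel of a morphism of finitely presented presheaves is finitely presented: a first weak
pullback gives a generator, a second one its relations. -/
lemma finPres_of_kernel [HasBinaryBiproducts K] [HasWeakKernels K]
    {M N N' : Kᵒᵖ ⥤ AddCommGrpCat.{w}} (hN : finPres K N) (hN' : finPres K N')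
    (u : M ⟶ N) (f : N ⟶ N') (hu : ∀ (R : K), Function.Injective (u.app (.op R)))
    (huf : ∀ (R : K) (x : N.obj (.op R)),
      f.app (.op R) x = 0 ↔ ∃ m : M.obj (.op R), u.app (.op R) m = x) : finPres K M := by
  obtain ⟨Q, P, d, n, h⟩ := hN
  obtain ⟨Q', P', d', n', h'⟩ := hN'
  obtain ⟨r₀, hr₀⟩ := h'.gen (f.app _ n)
  obtain ⟨W, a, b, hab, hW⟩ := exists_weakPullback r₀ d'
  obtain ⟨V, c, e, hce, hV⟩ := exists_weakPullback a d
  have hm : f.app _ (act N a n) = 0 := by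
    rw [app_act, ← hr₀, ← act_comp, hab, act_comp, h'.act_d, act_zero]
  obtain ⟨m, hm⟩ := (huf _ _).1 hm
  have hum : ∀ {R : K} (r : R ⟶ W), u.app _ (act M r m) = act N (r ≫ a) n := by
    intro R r
    rw [app_act, hm, act_comp]
  refine ⟨V, W, c, m, ⟨fun R x => ?_, fun R r => ?_, fun R r r' => ?_⟩⟩
  · obtain ⟨r, hr⟩ := h.gen (u.app _ x)
    have h₀ : act N' (r ≫ r₀) n' = 0 := by
      rw [act_comp, hr₀, ← app_act, hr]
      exact (huf _ _).2 ⟨x, rfl⟩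
    obtain ⟨s, hs⟩ := (h'.rel _).1 h₀
    obtain ⟨t, rfl, -⟩ := hW r s hs.symm
    exact ⟨t, hu _ (by rw [hum, hr])⟩
  · have : act M r m = 0 ↔ act N (r ≫ a) n = 0 := by
      rw [← hum]
      exact ⟨fun h => by rw [h, map_zero], fun h => hu _ (by rw [h, map_zero])⟩
    rw [this, h.rel]
    constructor
    · rintro ⟨s, hs⟩
      obtain ⟨t, ht, -⟩ := hV r s hs.symm
      exact ⟨t, ht⟩
    · rintro ⟨t, rfl⟩
      exact ⟨t ≫ e, by simp [hce]⟩
  · apply hu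
    rw [map_add, hum, hum, hum, Preadditive.add_comp, h.add]

lemma finPres_of_cokernel [HasBinaryBiproducts K]
    {M N N' : Kᵒᵖ ⥤ AddCommGrpCat.{w}} (hN : finPres K N) (hN' : finPres K N')
    (f : N ⟶ N') (g : N' ⟶ M) (hg : ∀ (R : K), Function.Surjective (g.app (.op R)))
    (hfg : ∀ (R : K) (x : N'.obj (.op R)),
      g.app (.op R) x = 0 ↔ ∃ m : N.obj (.op R), f.app (.op R) m = x) : finPres K M := by
  obtain ⟨Q, P, d, n, h⟩ := hN
  obtain ⟨Q', P', d', n', h'⟩ := hN'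
  obtain ⟨r₀, hr₀⟩ := h'.gen (f.app _ n)
  refine ⟨P ⊞ Q', P', biprod.desc r₀ d', g.app _ n', ⟨fun R x => ?_, fun R r => ?_,
    fun R r r' => ?_⟩⟩
  · obtain ⟨x, rfl⟩ := hg _ x
    obtain ⟨r, rfl⟩ := h'.gen x
    exact ⟨r, (app_act _ _ _).symm⟩
  · rw [← app_act, hfg]
    constructor
    · rintro ⟨m, hm⟩
      obtain ⟨s, rfl⟩ := h.gen m
      have : act N' (r - s ≫ r₀) n' = 0 := by
        rw [h'.sub, act_comp, hr₀, ← app_act, hm, sub_self]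
      obtain ⟨t, ht⟩ := (h'.rel _).1 this
      exact ⟨biprod.lift s t, by simp [ht]⟩
    · rintro ⟨t, rfl⟩
      refine ⟨act N (t ≫ biprod.fst) n, ?_⟩
      rw [app_act, ← hr₀, ← act_comp, biprod.desc_eq, Preadditive.comp_add, h'.add,
        ← Category.assoc t biprod.snd d', act_comp _ _ d', h'.act_d, act_zero, add_zero,
        Category.assoc]
  · rw [← app_act, ← app_act, ← app_act, h'.add, map_add]

lemma finPres_of_biprod [HasBinaryBiproducts K]
    {M N N' : Kᵒᵖ ⥤ AddCommGrpCat.{w}} (hN : finPres K N) (hN' : finPres K N')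
    (f : M ⟶ N) (f' : M ⟶ N')
    (hinj : ∀ (R : K) (x : M.obj (.op R)), f.app _ x = 0 → f'.app _ x = 0 → x = 0)
    (hsurj : ∀ (R : K) (y : N.obj (.op R)) (y' : N'.obj (.op R)),
      ∃ x : M.obj (.op R), f.app _ x = y ∧ f'.app _ x = y') : finPres K M := by
  obtain ⟨Q, P, d, n, h⟩ := hN
  obtain ⟨Q', P', d', n', h'⟩ := hN'
  have hinj' : ∀ (R : K) (x y : M.obj (.op R)), f.app _ x = f.app _ y →
      f'.app _ x = f'.app _ y → x = y := by
    intro R x y h₁ h₂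
    rw [← sub_eq_zero]
    exact hinj R _ (by rw [map_sub, h₁, sub_self]) (by rw [map_sub, h₂, sub_self])
  obtain ⟨m, hm, hm'⟩ := hsurj (P ⊞ P') (act N biprod.fst n) (act N' biprod.snd n')
  have hf : ∀ {R : K} (r : R ⟶ P ⊞ P'), f.app _ (act M r m) = act N (r ≫ biprod.fst) n := by
    intro R r
    rw [app_act, hm, act_comp]
  have hf' : ∀ {R : K} (r : R ⟶ P ⊞ P'), f'.app _ (act M r m) = act N' (r ≫ biprod.snd) n' := by
    intro R r
    rw [app_act, hm', act_comp]
  refine ⟨Q ⊞ Q', P ⊞ P', biprod.map d d', m, ⟨fun R x => ?_, fun R r => ?_, fun R r r' => ?_⟩⟩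
  · obtain ⟨r, hr⟩ := h.gen (f.app _ x)
    obtain ⟨r', hr'⟩ := h'.gen (f'.app _ x)
    exact ⟨biprod.lift r r', hinj' _ _ _ (by rw [hf, biprod.lift_fst, hr])
      (by rw [hf', biprod.lift_snd, hr'])⟩
  · constructor
    · intro h₀
      obtain ⟨s, hs⟩ := (h.rel (r ≫ biprod.fst)).1 (by rw [← hf, h₀, map_zero])
      obtain ⟨s', hs'⟩ := (h'.rel (r ≫ biprod.snd)).1 (by rw [← hf', h₀, map_zero])
      exact ⟨biprod.lift s s', by ext <;> simp [hs, hs']⟩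
    · rintro ⟨t, rfl⟩
      apply hinj
      · rw [hf, h.rel]
        exact ⟨t ≫ biprod.fst, by simp⟩
      · rw [hf', h'.rel]
        exact ⟨t ≫ biprod.snd, by simp⟩
  · apply hinj'
    · rw [map_add, hf, hf, hf, Preadditive.add_comp, h.add]
    · rw [map_add, hf', hf', hf', Preadditive.add_comp, h'.add]

lemma finPres_of_isZero [HasZeroObject K] {M : Kᵒᵖ ⥤ AddCommGrpCat.{w}}
    (hM : ∀ (R : K) (x : M.obj (.op R)), x = 0) : finPres K M := by
  obtain ⟨Z, hZ⟩ := HasZeroObject.zero (C := K)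
  exact ⟨Z, Z, 𝟙 Z, 0, ⟨fun R x => ⟨0, by simp [hM _ x]⟩,
    fun R r => ⟨fun _ => ⟨r, by simp⟩, fun _ => act_zero _ _⟩, fun R r r' => by simp⟩⟩

instance : (finPres.{w} K).IsClosedUnderIsomorphisms where
  of_iso := by
    rintro N N' e ⟨Q, P, d, n, h⟩
    have hinj : ∀ (R : K), Function.Injective (e.hom.app (.op R)) := fun R =>
      (AddCommGrpCat.mono_iff_injective _).1 inferInstance
    refine ⟨Q, P, d, e.hom.app _ n, ⟨fun R x => ?_, fun R r => ?_, fun R r r' => ?_⟩⟩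
    · obtain ⟨r, hr⟩ := h.gen (e.inv.app _ x)
      refine ⟨r, ?_⟩
      rw [← app_act, hr]
      simp
    · rw [← h.rel, ← app_act]
      exact ⟨fun h => hinj _ (by rw [h, map_zero]), fun h => by rw [h, map_zero]⟩
    · rw [← app_act, ← app_act, ← app_act, h.add, map_add]

variable [HasZeroObject K] [HasBinaryBiproducts K] [HasWeakKernels K]

omit [HasBinaryBiproducts K] [HasWeakKernels K] in
instance : (finPres.{w} K).ContainsZero where
  exists_zero := by
    obtain ⟨Z, hZ⟩ := HasZeroObject.zero (C := Kᵒᵖ ⥤ AddCommGrpCat.{w})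
    refine ⟨Z, hZ, finPres_of_isZero fun R x => ?_⟩
    have := AddCommGrpCat.subsingleton_of_isZero ((Functor.isZero_iff _).1 hZ (.op R))
    exact Subsingleton.elim _ _

instance : (finPres.{w} K).IsClosedUnderKernels where
  kernels_le := by
    rintro M ⟨f, k, hk, hN, hN'⟩
    have hS := (ShortComplex.mk k.ι f k.condition).exact_of_f_is_kernel
      (IsLimit.ofIsoLimit hk (Fork.ext (Iso.refl _) (by simp)))
    have : Mono k.ι := Fork.IsLimit.mono hk
    refine finPres_of_kernel hN hN' k.ι f
      (fun R => (AddCommGrpCat.mono_iff_injective _).1 inferInstance) fun R x => ?_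
    have := hS.map ((evaluation _ _).obj (.op R))
    rw [ShortComplex.ab_exact_iff] at this
    refine ⟨this x, ?_⟩
    rintro ⟨m, rfl⟩
    exact ConcreteCategory.congr_hom (NatTrans.congr_app k.condition (.op R)) m

omit [HasZeroObject K] [HasWeakKernels K] in
instance : (finPres.{w} K).IsClosedUnderCokernels where
  cokernels_le := by
    rintro M ⟨f, k, hk, hN, hN'⟩
    have hS := (ShortComplex.mk f k.π k.condition).exact_of_g_is_cokernel
      (IsColimit.ofIsoColimit hk (Cofork.ext (Iso.refl _) (by simp)))
    have : Epi k.π := Cofork.IsColimit.epi hk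
    refine finPres_of_cokernel hN hN' f k.π
      (fun R => (AddCommGrpCat.epi_iff_surjective _).1 inferInstance) fun R x => ?_
    have := hS.map ((evaluation _ _).obj (.op R))
    rw [ShortComplex.ab_exact_iff] at this
    refine ⟨this x, ?_⟩
    rintro ⟨m, rfl⟩
    exact ConcreteCategory.congr_hom (NatTrans.congr_app k.condition (.op R)) m

omit [HasZeroObject K] [HasWeakKernels K] in
lemma finPres_biprod {N N' : Kᵒᵖ ⥤ AddCommGrpCat.{w}} (hN : finPres K N) (hN' : finPres K N') :
    finPres K (N ⊞ N') := by
  let i : N ⟶ N ⊞ N' := biprod.inl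
  let i' : N' ⟶ N ⊞ N' := biprod.inr
  let q : N ⊞ N' ⟶ N := biprod.fst
  let q' : N ⊞ N' ⟶ N' := biprod.snd
  have total (R : K) (x : (N ⊞ N').obj (.op R)) :
      i.app _ (q.app _ x) + i'.app _ (q'.app _ x) = x :=
    ConcreteCategory.congr_hom (NatTrans.congr_app (biprod.total (X := N) (Y := N')) (.op R)) x
  refine finPres_of_biprod hN hN' q q' (fun R x h₁ h₂ => ?_) fun R y y' => ?_
  · rw [← total R x, h₁, h₂, map_zero, map_zero, add_zero]
  · refine ⟨i.app _ y + i'.app _ y', ?_, ?_⟩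
    · simp [i, i', q, ← ConcreteCategory.comp_apply, ← NatTrans.comp_app]
    · simp [i, i', q', ← ConcreteCategory.comp_apply, ← NatTrans.comp_app]

omit [HasZeroObject K] [HasWeakKernels K] in
instance : (finPres.{w} K).IsClosedUnderBinaryProducts where
  limitsOfShape_le := by
    rintro M ⟨p⟩
    let e : M ≅ p.diag.obj ⟨.left⟩ ⊞ p.diag.obj ⟨.right⟩ :=
      p.isLimit.conePointUniqueUpToIso (limit.isLimit _) ≪≫
        HasLimit.isoOfNatIso (diagramIsoPair p.diag) ≪≫ (biprod.isoProd _ _).symm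
    exact (finPres K).prop_of_iso e.symm
      (finPres_biprod (p.prop_diag_obj ⟨.left⟩) (p.prop_diag_obj ⟨.right⟩))

instance : (finPres.{w} K).IsClosedUnderFiniteProducts :=
  ObjectProperty.IsClosedUnderFiniteProducts.mk'

end Presheaves
/-! ### Extension of functors to finitely presented presheaves -/

section Extension

variable {K : Type u} [Category.{v} K] [Preadditive K]
  {A : Type u'} [Category.{v'} A] [Abelian A] (E : K ⥤ A) [E.Additive]

/-- A morphism `d` is a weak kernel of `f`. -/
def IsWeakKernel {Q P S : K} (d : Q ⟶ P) (f : P ⟶ S) : Prop :=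
  d ≫ f = 0 ∧ ∀ ⦃R : K⦄ (r : R ⟶ P), r ≫ f = 0 → ∃ s : R ⟶ Q, s ≫ d = r

/-- The property of a functor to an abelian category to map weak kernels to exact sequences. It
is what makes the extension to finitely presented presheaves exact. -/
def MapsWeakKernelsToExact : Prop :=
  ∀ ⦃Q P S : K⦄ (d : Q ⟶ P) (f : P ⟶ S) (h : IsWeakKernel d f),
    (ShortComplex.mk (E.map d) (E.map f) (by rw [← E.map_comp, h.1, E.map_zero])).Exact

variable {E}

lemma MapsWeakKernelsToExact.weakPullback [HasBinaryBiproducts K] (hE : MapsWeakKernelsToExact E)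
    {W P Q S : K} {a : P ⟶ S} {b : Q ⟶ S} {x : W ⟶ P} {y : W ⟶ Q} (h : x ≫ a = y ≫ b)
    (hW : ∀ {R : K} (r : R ⟶ P) (s : R ⟶ Q), r ≫ a = s ≫ b → ∃ t : R ⟶ W, t ≫ x = r ∧ t ≫ y = s)
    {X : A} (z : X ⟶ E.obj P) (t : X ⟶ E.obj Q) (hzt : z ≫ E.map a = t ≫ E.map b) :
    ∃ (X' : A) (π : X' ⟶ X) (_ : Epi π) (s : X' ⟶ E.obj W), π ≫ z = s ≫ E.map x := by
  have hk : IsWeakKernel (biprod.lift x y) (biprod.fst ≫ a - biprod.snd ≫ b) := by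
    refine ⟨by simp [h], fun R r hr => ?_⟩
    rw [Preadditive.comp_sub, sub_eq_zero, ← Category.assoc, ← Category.assoc] at hr
    obtain ⟨t, h₁, h₂⟩ := hW _ _ hr
    exact ⟨t, by ext <;> simp [h₁, h₂]⟩
  obtain ⟨X', π, _, s, hs⟩ := (hE _ _ hk).exact_up_to_refinements
    (z ≫ E.map biprod.inl + t ≫ E.map biprod.inr) (by
      simp only [Preadditive.add_comp, Category.assoc, ← E.map_comp]
      simp [hzt])
  refine ⟨X', π, inferInstance, s, ?_⟩
  have := congrArg (· ≫ E.map biprod.fst) hs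
  dsimp at this
  simp only [Preadditive.add_comp, Category.assoc, ← E.map_comp] at this
  simpa using this

section

variable (N N' : (finPres.{w} K).FullSubcategory)

/-- The source of the morphism in a chosen presentation of `N`. -/
noncomputable def relObj : K := N.property.choose

/-- The target of the morphism in a chosen presentation of `N`. -/
noncomputable def genObj : K := N.property.choose_spec.choose

/-- The morphism in a chosen presentation of `N`. -/
noncomputable def relMap : relObj N ⟶ genObj N := N.property.choose_spec.choose_spec.choose

/-- The generator in a chosen presentation of `N`. -/
noncomputable def genElt : N.obj.obj (.op (genObj N)) :=
  N.property.choose_spec.choose_spec.choose_spec.choose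

lemma isPresentation : IsPresentation N.obj (relMap N) (genElt N) :=
  N.property.choose_spec.choose_spec.choose_spec.choose_spec

variable {N N'}

lemma exists_lift (f : N ⟶ N') : ∃ r : genObj N ⟶ genObj N',
    act N'.obj r (genElt N') = f.hom.app _ (genElt N) :=
  (isPresentation N').gen _

lemma exists_lift_rel (f : N ⟶ N') {r : genObj N ⟶ genObj N'}
    (hr : act N'.obj r (genElt N') = f.hom.app _ (genElt N)) :
    ∃ s : relObj N ⟶ relObj N', s ≫ relMap N' = relMap N ≫ r := by
  rw [← (isPresentation N').rel, act_comp, hr, ← app_act, (isPresentation N).act_d, map_zero]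

variable (E) in
/-- The value at `N` of the extension of `E`: the cokernel of the image under `E` of a
presentation of `N`. -/
noncomputable def extObj (N : (finPres.{w} K).FullSubcategory) : A :=
  cokernel (E.map (relMap N))

variable (E) in
/-- The projection to the value at `N` of the extension of `E`. -/
noncomputable def extπ (N : (finPres.{w} K).FullSubcategory) :
    E.obj (genObj N) ⟶ extObj E N :=
  cokernel.π (E.map (relMap N))

omit [E.Additive] in
instance : Epi (extπ E N) := inferInstanceAs (Epi (cokernel.π (E.map (relMap N))))

omit [E.Additive] in
lemma map_relMap_extπ : E.map (relMap N) ≫ extπ E N = 0 := cokernel.condition _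

omit [E.Additive] in
lemma exact_extπ : (ShortComplex.mk (E.map (relMap N)) (extπ E N) map_relMap_extπ).Exact :=
  ShortComplex.exact_cokernel _

lemma map_extπ_eq_of_act_eq {P : K} (r r' : P ⟶ genObj N)
    (h : act N.obj r (genElt N) = act N.obj r' (genElt N)) :
    E.map r ≫ extπ E N = E.map r' ≫ extπ E N := by
  have : act N.obj (r - r') (genElt N) = 0 := by
    rw [(isPresentation N).sub, h, sub_self]
  obtain ⟨s, hs⟩ := ((isPresentation N).rel _).1 this
  rw [← sub_eq_zero, ← Preadditive.sub_comp, ← E.map_sub, ← hs, E.map_comp, Category.assoc,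
    map_relMap_extπ, comp_zero]

lemma exists_extMap (f : N ⟶ N') : ∃ φ : extObj E N ⟶ extObj E N',
    ∀ r : genObj N ⟶ genObj N', act N'.obj r (genElt N') = f.hom.app _ (genElt N) →
      extπ E N ≫ φ = E.map r ≫ extπ E N' := by
  obtain ⟨r, hr⟩ := exists_lift f
  obtain ⟨s, hs⟩ := exists_lift_rel f hr
  refine ⟨cokernel.desc _ (E.map r ≫ extπ E N') ?_, fun r' hr' => ?_⟩
  · rw [← E.map_comp_assoc, ← hs, E.map_comp, Category.assoc, map_relMap_extπ, comp_zero]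
  · exact (cokernel.π_desc _ _ _).trans (map_extπ_eq_of_act_eq _ _ (hr.trans hr'.symm))

variable (E) in
/-- The action on morphisms of the extension of `E`. -/
noncomputable def extMap (f : N ⟶ N') : extObj E N ⟶ extObj E N' := (exists_extMap f).choose

lemma extπ_extMap (f : N ⟶ N') {r : genObj N ⟶ genObj N'}
    (hr : act N'.obj r (genElt N') = f.hom.app _ (genElt N)) :
    extπ E N ≫ extMap E f = E.map r ≫ extπ E N' := (exists_extMap f).choose_spec r hr

end

variable (E) in
/-- The extension of a functor `E` on `K` to finitely presented presheaves. -/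
noncomputable def extFunctor : (finPres.{w} K).FullSubcategory ⥤ A where
  obj := extObj E
  map := extMap E
  map_id N := by
    rw [← cancel_epi (extπ E N), extπ_extMap (r := 𝟙 _) _ (by simp)]
    simp
  map_comp {N N' N''} f g := by
    obtain ⟨r, hr⟩ := exists_lift f
    obtain ⟨s, hs⟩ := exists_lift g
    rw [← cancel_epi (extπ E N), ← Category.assoc, extπ_extMap f hr, Category.assoc,
      extπ_extMap g hs, extπ_extMap (f ≫ g) (r := r ≫ s), E.map_comp, Category.assoc]
    rw [act_comp, hs, ← app_act, hr]
    simp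

instance : (extFunctor.{w} E).Additive where
  map_add {N N' f g} := by
    obtain ⟨r, hr⟩ := exists_lift f
    obtain ⟨s, hs⟩ := exists_lift g
    change extMap E (f + g) = extMap E f + extMap E g
    rw [← cancel_epi (extπ E N), Preadditive.comp_add, extπ_extMap f hr,
      extπ_extMap g hs, extπ_extMap (f + g) (r := r + s), E.map_add, Preadditive.add_comp]
    rw [(isPresentation N').add, hs, hr]
    rfl

variable [HasZeroObject K] [HasBinaryBiproducts K] [HasWeakKernels K]

instance : (finPres.{w} K).ι.PreservesHomology where
  preservesKernels := (finPres.{w} K).preservesKernels_ι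
  preservesCokernels := (finPres.{w} K).preservesCokernels_ι

/-- Exactness of sequences of finitely presented presheaves is tested on elements. -/
lemma exact_finPres_iff (S : ShortComplex (finPres.{w} K).FullSubcategory) :
    S.Exact ↔ ∀ (P : K) (x : S.X₂.obj.obj (.op P)), S.g.hom.app _ x = 0 →
      ∃ y : S.X₁.obj.obj (.op P), S.f.hom.app _ y = x := by
  rw [← S.exact_map_iff_of_faithful (finPres.{w} K).ι]
  constructor
  · intro h P x
    have := h.map ((evaluation _ _).obj (.op P))
    rw [ShortComplex.ab_exact_iff] at this
    exact this x
  · intro h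
    refine exact_of_evaluation _ fun ⟨P⟩ => ?_
    rw [ShortComplex.ab_exact_iff]
    exact h P

/-- Exactness of the extension, tested on generalized elements: `x` is represented by a generalized
element of `E (genObj S.X₂)`, whose image in `E (genObj S.X₃)` consists of relations, so that it
factors through a weak pullback on which the generator of `S.X₂` comes from `S.X₁`. -/
lemma extMap_exact_up_to_refinements (hE : MapsWeakKernelsToExact E)
    (S : ShortComplex (finPres.{w} K).FullSubcategory) (hS : S.Exact) {X : A}
    (x : X ⟶ extObj E S.X₂) (hx : x ≫ extMap E S.g = 0) :
    ∃ (X' : A) (π : X' ⟶ X) (_ : Epi π) (y : X' ⟶ extObj E S.X₁),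
      π ≫ x = y ≫ extMap E S.f := by
  rw [exact_finPres_iff] at hS
  obtain ⟨a, ha⟩ := exists_lift S.f
  obtain ⟨b, hb⟩ := exists_lift S.g
  obtain ⟨W, p, q, hpq, hW⟩ := exists_weakPullback b (relMap S.X₃)
  -- on `W`, the generator of the middle term is in the image of the first term
  have h₀ : S.g.hom.app _ (act S.X₂.obj p (genElt S.X₂)) = 0 := by
    rw [app_act, ← hb, ← act_comp, hpq, act_comp, (isPresentation S.X₃).act_d, act_zero]
  obtain ⟨y, hy⟩ := hS _ _ h₀
  obtain ⟨t, rfl⟩ := (isPresentation S.X₁).gen y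
  rw [app_act, ← ha, ← act_comp] at hy
  obtain ⟨X₁, π₁, _, x₁, hx₁⟩ := surjective_up_to_refinements_of_epi (extπ E S.X₂) x
  obtain ⟨X₂, π₂, _, x₂, hx₂⟩ := exact_extπ.exact_up_to_refinements (x₁ ≫ E.map b) (by
    dsimp
    rw [Category.assoc, ← extπ_extMap S.g hb, ← reassoc_of% hx₁, hx, comp_zero])
  obtain ⟨X₃, π₃, _, x₃, hx₃⟩ := hE.weakPullback hpq hW (π₂ ≫ x₁) x₂
    (by simpa using hx₂)
  refine ⟨X₃, π₃ ≫ π₂ ≫ π₁, inferInstance, x₃ ≫ E.map t ≫ extπ E S.X₁, ?_⟩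
  simp only [Category.assoc]
  rw [hx₁, extπ_extMap S.f ha, ← E.map_comp_assoc, map_extπ_eq_of_act_eq _ _ hy,
    ← reassoc_of% hx₃]

lemma extFunctor_map_exact (hE : MapsWeakKernelsToExact E)
    (S : ShortComplex (finPres.{w} K).FullSubcategory) (hS : S.Exact) :
    (S.map (extFunctor E)).Exact := by
  rw [ShortComplex.exact_iff_exact_up_to_refinements]
  exact fun X x hx => extMap_exact_up_to_refinements hE S hS x hx

lemma extFunctor_preserves (hE : MapsWeakKernelsToExact E) :
    PreservesFiniteLimits (extFunctor.{w} E) ∧ PreservesFiniteColimits (extFunctor.{w} E) :=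
  ((extFunctor.{w} E).exact_tfae.out 1 3).1 (extFunctor_map_exact hE)

end Extension
/-! ### The universal functor on relative projective objects -/

section Universal

variable {T : Type u} [Category.{v} T] [HasZeroObject T] [HasShift T ℤ] [Preadditive T]
  [∀ n : ℤ, (shiftFunctor T n).Additive] [Pretriangulated T] {J : MorphismProperty T}

instance : (IsProj J).ContainsZero where
  exists_zero :=
    have ⟨Z, hZ⟩ := HasZeroObject.zero (C := T)
    ⟨Z, hZ, fun _ _ _ _ _ => hZ.eq_of_src _ _⟩

instance : (IsProj J).IsClosedUnderBinaryProducts where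
  limitsOfShape_le := by
    rintro P ⟨p⟩ X Y f hf g
    let e : P ≅ p.diag.obj ⟨.left⟩ ⊞ p.diag.obj ⟨.right⟩ :=
      p.isLimit.conePointUniqueUpToIso (limit.isLimit _) ≪≫
        HasLimit.isoOfNatIso (diagramIsoPair p.diag) ≪≫ (biprod.isoProd _ _).symm
    rw [← cancel_epi e.inv]
    ext
    · simpa using p.prop_diag_obj ⟨.left⟩ f hf (biprod.inl ≫ e.inv ≫ g)
    · simpa using p.prop_diag_obj ⟨.right⟩ f hf (biprod.inr ≫ e.inv ≫ g)

lemma IsProj.of_retract {P Q : T} (hP : IsProj J P) (i : Q ⟶ P) (r : P ⟶ Q) (h : i ≫ r = 𝟙 Q) :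
    IsProj J Q := fun X Y f hf g => by
  have := hP f hf (r ≫ g)
  rw [← Category.id_comp (g ≫ f), ← h, Category.assoc, ← Category.assoc r, this, comp_zero]

instance : (IsProj J).IsClosedUnderIsomorphisms where
  of_iso e h := h.of_retract e.inv e.hom (by simp)

instance : (IsProj J).IsClosedUnderFiniteProducts :=
  ObjectProperty.IsClosedUnderFiniteProducts.mk'

instance : HasBinaryBiproducts (IsProj J).FullSubcategory :=
  HasBinaryBiproducts.of_hasBinaryProducts

/-- Morphisms from relative projective objects lift along relative epimorphisms. -/
lemma IsEpic.exists_lift {X Y R : T} {p : X ⟶ Y} (hp : IsEpic J p) (hR : IsProj J R)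
    (r : R ⟶ Y) : ∃ s : R ⟶ X, s ≫ p = r := by
  obtain ⟨Z, q, t, hT, hq⟩ := hp
  obtain ⟨s, hs⟩ := Triangle.coyoneda_exact₂ _ hT r (hR q hq r)
  exact ⟨s, hs.symm⟩

lemma EnoughProj.hasWeakKernels (hJ : EnoughProj J) :
    HasWeakKernels (IsProj J).FullSubcategory where
  hasWeakLimit f := by
    obtain ⟨Z, i, p, hT⟩ := distinguished_cocone_triangle₁ f.hom
    obtain ⟨R, q, hR, hq⟩ := hJ Z
    have hi : i ≫ f.hom = 0 := comp_distTriang_mor_zero₁₂ _ hT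
    refine ⟨⟨KernelFork.ofι (Z := ⟨R, hR⟩) (ObjectProperty.homMk (q ≫ i)) ?_,
      Fork.IsWeakLimit.mk' _ fun s => ?_⟩⟩
    · ext
      change (q ≫ i) ≫ f.hom = 0
      rw [Category.assoc, hi, comp_zero]
    · have h : s.ι.hom ≫ f.hom = 0 := congrArg (·.hom) (KernelFork.condition s)
      have h₁ := Triangle.coyoneda_exact₂ _ hT s.ι.hom h
      have h₂ := hq.exists_lift s.pt.property h₁.choose
      refine ⟨ObjectProperty.homMk h₂.choose, ?_⟩
      ext
      change h₂.choose ≫ q ≫ i = s.ι.hom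
      rw [← Category.assoc, h₂.choose_spec]
      exact h₁.choose_spec.symm

variable (J) in
/-- The presheaf on the category of relative projective objects represented by an object. -/
def projYonedaObj (X : T) : (IsProj J).FullSubcategoryᵒᵖ ⥤ AddCommGrpCat.{max v w} where
  obj P := AddCommGrpCat.of (ULift.{w} (P.unop.obj ⟶ X))
  map r := AddCommGrpCat.ofHom
    { toFun := fun g => ⟨r.unop.hom ≫ g.down⟩
      map_zero' := by ext; simp
      map_add' := fun g g' => by ext; simp }
  map_id P := by ext; simp
  map_comp r s := by ext; simp

lemma act_projYonedaObj (X : T) {R P : (IsProj J).FullSubcategory} (r : R ⟶ P) (g : P.obj ⟶ X) :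
    act (projYonedaObj.{w} J X) r ⟨g⟩ = ⟨r.hom ≫ g⟩ := rfl

lemma finPres_projYonedaObj (hJ : EnoughProj J) (X : T) :
    finPres _ (projYonedaObj.{w} J X) := by
  obtain ⟨P, p, hP, hp⟩ := hJ X
  obtain ⟨Z, i, q, hT⟩ := distinguished_cocone_triangle₁ p
  obtain ⟨R, r, hR, hr⟩ := hJ Z
  have hi : i ≫ p = 0 := comp_distTriang_mor_zero₁₂ _ hT
  refine ⟨⟨R, hR⟩, ⟨P, hP⟩, ObjectProperty.homMk (r ≫ i), ⟨p⟩, ⟨fun S x => ?_, fun S s => ?_,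
    fun S s s' => ?_⟩⟩
  · obtain ⟨t, ht⟩ := hp.exists_lift S.property x.down
    refine ⟨ObjectProperty.homMk t, ?_⟩
    rw [act_projYonedaObj]
    exact ULift.ext _ _ ht
  · rw [act_projYonedaObj]
    constructor
    · intro h
      obtain ⟨t, ht⟩ := Triangle.coyoneda_exact₂ _ hT s.hom (congrArg ULift.down h)
      obtain ⟨t', ht'⟩ := hr.exists_lift S.property t
      refine ⟨ObjectProperty.homMk t', ?_⟩
      ext
      change t' ≫ r ≫ i = s.hom
      rw [← Category.assoc, ht']
      exact ht.symm
    · rintro ⟨t, rfl⟩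
      apply ULift.ext
      change (t.hom ≫ r ≫ i) ≫ p = 0
      simp [hi]
  · rw [act_projYonedaObj, act_projYonedaObj, act_projYonedaObj]
    apply ULift.ext
    exact Preadditive.add_comp _ _ _ _ _ _

/-- The functor that maps an object to the presheaf it represents on the category of relative
projective objects. -/
def projYoneda (hJ : EnoughProj J) :
    T ⥤ (finPres.{max v w} (IsProj J).FullSubcategory).FullSubcategory where
  obj X := ⟨projYonedaObj.{w} J X, finPres_projYonedaObj hJ X⟩
  map f := ObjectProperty.homMk
    { app := fun P => AddCommGrpCat.ofHom
        { toFun := fun g => ⟨g.down ≫ f⟩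
          map_zero' := by ext; simp
          map_add' := fun g g' => by ext; simp }
      naturality := fun P Q r => by
        ext x
        apply ULift.ext
        exact Category.assoc _ _ _ }
  map_id X := by
    ext P x
    apply ULift.ext
    exact Category.comp_id _
  map_comp f g := by
    ext P x
    apply ULift.ext
    exact (Category.assoc _ _ _).symm

lemma projYoneda_map_eq_zero (hJ : EnoughProj J) {X Y : T} (f : X ⟶ Y) (hf : J f) :
    (projYoneda.{w} hJ).map f = 0 := by
  ext P x
  apply ULift.ext
  exact P.unop.property f hf x.down

lemma projYoneda_isHomological (hJ : EnoughProj J) :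
    letI := hJ.hasWeakKernels
    (projYoneda.{w} hJ).IsHomological :=
  letI := hJ.hasWeakKernels
  { map_zero := fun X Y => by
      ext P x
      apply ULift.ext
      exact comp_zero
    exact := fun t ht => by
      rw [exact_finPres_iff]
      rintro P ⟨x⟩ hx
      obtain ⟨y, hy⟩ := t.coyoneda_exact₂ ht x (congrArg ULift.down hx)
      exact ⟨⟨y⟩, ULift.ext _ _ hy.symm⟩ }

variable {A : Type u'} [Category.{v'} A] [Abelian A] {F : T ⥤ A} [F.IsHomological]

lemma epi_map_of_isEpic (hF : ∀ ⦃X Y : T⦄ (f : X ⟶ Y), J f → F.map f = 0) {X Y : T} {p : X ⟶ Y}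
    (hp : IsEpic J p) : Epi (F.map p) := by
  obtain ⟨Z, q, t, hT, hq⟩ := hp
  have := (F.map_distinguished_exact _ hT)
  exact this.epi_f (hF q hq)

/-- A sequence that is exact with respect to morphisms from relative projective objects is mapped
to an exact sequence by functors that annihilate the ideal. -/
lemma map_exact_of_proj (hJ : EnoughProj J) (hF : ∀ ⦃X Y : T⦄ (f : X ⟶ Y), J f → F.map f = 0)
    {Q P X : T} (d : Q ⟶ P) (n : P ⟶ X) (hdn : d ≫ n = 0)
    (h : ∀ ⦃R : T⦄, IsProj J R → ∀ r : R ⟶ P, r ≫ n = 0 → ∃ s : R ⟶ Q, s ≫ d = r) :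
    (ShortComplex.mk (F.map d) (F.map n) (by rw [← F.map_comp, hdn, F.map_zero])).Exact := by
  obtain ⟨Z, i, q, hT⟩ := distinguished_cocone_triangle₁ n
  obtain ⟨R, r, hR, hr⟩ := hJ Z
  have hi : i ≫ n = 0 := comp_distTriang_mor_zero₁₂ _ hT
  have := epi_map_of_isEpic hF hr
  obtain ⟨s, hs⟩ := h hR (r ≫ i) (by rw [Category.assoc, hi, comp_zero])
  rw [ShortComplex.exact_iff_exact_up_to_refinements]
  intro Y (x : Y ⟶ F.obj P) hx
  obtain ⟨Y₁, π₁, _, (y : Y₁ ⟶ F.obj Z), (hy : π₁ ≫ x = y ≫ F.map i)⟩ :=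
    (F.map_distinguished_exact _ hT).exact_up_to_refinements x hx
  obtain ⟨Y₂, π₂, _, z, hz⟩ := surjective_up_to_refinements_of_epi (F.map r) y
  refine ⟨Y₂, π₂ ≫ π₁, inferInstance, z ≫ F.map s, ?_⟩
  change (π₂ ≫ π₁) ≫ x = (z ≫ F.map s) ≫ F.map d
  rw [Category.assoc, hy, reassoc_of% hz, ← F.map_comp, ← hs, F.map_comp, Category.assoc]

lemma mapsWeakKernelsToExact (hJ : EnoughProj J)
    (hF : ∀ ⦃X Y : T⦄ (f : X ⟶ Y), J f → F.map f = 0) :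
    MapsWeakKernelsToExact ((IsProj J).ι ⋙ F) := fun Q P S d f h => by
  refine map_exact_of_proj hJ hF d.hom f.hom (congrArg (·.hom) h.1) fun R hR r hr => ?_
  obtain ⟨s, hs⟩ := h.2 (R := ⟨R, hR⟩) (ObjectProperty.homMk r) (by ext; exact hr)
  exact ⟨s.hom, congrArg (·.hom) hs⟩

section

variable (hJ : EnoughProj J) (hF : ∀ ⦃X Y : T⦄ (f : X ⟶ Y), J f → F.map f = 0)

/-- The morphism that exhibits an object as the target of the generator in a presentation of the
presheaf it represents. -/
noncomputable def genHom (X : T) : (genObj ((projYoneda.{w} hJ).obj X)).obj ⟶ X :=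
  ULift.down (genElt ((projYoneda.{w} hJ).obj X))

lemma relMap_genHom (X : T) :
    (relMap ((projYoneda.{w} hJ).obj X)).hom ≫ genHom.{w} hJ X = 0 :=
  congrArg ULift.down (isPresentation ((projYoneda.{w} hJ).obj X)).act_d

include hF in
lemma map_genHom_exact (X : T) :
    (ShortComplex.mk (F.map (relMap ((projYoneda.{w} hJ).obj X)).hom) (F.map (genHom.{w} hJ X))
      (by rw [← F.map_comp, relMap_genHom, F.map_zero])).Exact := by
  refine map_exact_of_proj hJ hF _ _ (relMap_genHom hJ X) fun R hR r hr => ?_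
  obtain ⟨s, hs⟩ := ((isPresentation ((projYoneda.{w} hJ).obj X)).rel (R := ⟨R, hR⟩)
    (ObjectProperty.homMk r)).1 (ULift.ext _ _ hr)
  exact ⟨s.hom, congrArg (·.hom) hs⟩

include hF in
lemma epi_map_genHom (X : T) : Epi (F.map (genHom.{w} hJ X)) := by
  obtain ⟨P, p, hP, hp⟩ := hJ X
  obtain ⟨r, hr⟩ := (isPresentation ((projYoneda.{w} hJ).obj X)).gen (R := ⟨P, hP⟩) ⟨p⟩
  have hr' : r.hom ≫ genHom.{w} hJ X = p := congrArg ULift.down hr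
  have := epi_map_of_isEpic hF hp
  rw [← hr', F.map_comp] at this
  exact epi_of_epi (F.map r.hom) _

/-- The value at `X` of the extension of `F` from relative projective objects to finitely
presented presheaves, evaluated at the presheaf represented by `X`, is `F X`. -/
noncomputable def extProjYonedaIso (X : T) :
    extObj ((IsProj J).ι ⋙ F) ((projYoneda.{w} hJ).obj X) ≅ F.obj X :=
  have := epi_map_genHom.{w} hJ hF X
  (cokernelIsCokernel _).coconePointUniqueUpToIso (map_genHom_exact.{w} hJ hF X).gIsCokernel

lemma extπ_extProjYonedaIso (X : T) :
    extπ ((IsProj J).ι ⋙ F) ((projYoneda.{w} hJ).obj X) ≫ (extProjYonedaIso hJ hF X).hom =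
      F.map (genHom.{w} hJ X) :=
  have := epi_map_genHom.{w} hJ hF X
  (cokernelIsCokernel _).comp_coconePointUniqueUpToIso_hom
    (map_genHom_exact.{w} hJ hF X).gIsCokernel .one

lemma extProjYonedaIso_naturality {X Y : T} (f : X ⟶ Y) :
    extMap ((IsProj J).ι ⋙ F) ((projYoneda.{w} hJ).map f) ≫ (extProjYonedaIso hJ hF Y).hom =
      (extProjYonedaIso hJ hF X).hom ≫ F.map f := by
  rw [← cancel_epi (extπ ((IsProj J).ι ⋙ F) ((projYoneda.{w} hJ).obj X))]
  obtain ⟨r, hr⟩ := exists_lift ((projYoneda.{w} hJ).map f)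
  have hr' : r.hom ≫ genHom.{w} hJ Y = genHom.{w} hJ X ≫ f := congrArg ULift.down hr
  rw [← Category.assoc, extπ_extMap _ hr, Category.assoc, extπ_extProjYonedaIso,
    ← Category.assoc, extπ_extProjYonedaIso, ← F.map_comp, ← hr', F.map_comp]
  rfl

/-- The extension of `F` from relative projective objects to finitely presented presheaves agrees
with `F` on representable presheaves. -/
noncomputable def projYonedaCompExt :
    projYoneda.{w} hJ ⋙ extFunctor ((IsProj J).ι ⋙ F) ≅ F :=
  NatIso.ofComponents (extProjYonedaIso hJ hF) (extProjYonedaIso_naturality hJ hF)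

end

end Universal
/-! ### Projective approximations -/

section Approximation

variable {T : Type u} [Category.{v} T] [HasZeroObject T] [HasShift T ℤ] [Preadditive T]
  [∀ n : ℤ, (shiftFunctor T n).Additive] [Pretriangulated T] {J : MorphismProperty T}
  {A : Type u'} [Category.{v'} A] [Abelian A] [HasShift A ℤ]
  [∀ n : ℤ, (shiftFunctor A n).Additive]
  (F : T ⥤ A) [F.CommShift ℤ] [F.IsHomological]

/-- The properties of the universal exact homological functor that obstruction theory uses: its
kernel on morphisms is `J`, and it identifies relative projective objects with enough projective
objects of the target. -/
structure IsProjectiveApproximation (J : MorphismProperty T) (F : T ⥤ A) : Prop where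
  map_eq_zero_iff : ∀ ⦃X Y : T⦄ (f : X ⟶ Y), F.map f = 0 ↔ J f
  exists_map_eq : ∀ ⦃P X : T⦄, IsProj J P → ∀ h : F.obj P ⟶ F.obj X, ∃ g : P ⟶ X, F.map g = h
  projective : ∀ ⦃P : T⦄, IsProj J P → Projective (F.obj P)
  exists_epi : ∀ M : A, ∃ (P : T) (_ : IsProj J P) (p : F.obj P ⟶ M), Epi p

lemma projYoneda_hom_ext (hE : EnoughProj J) {P : T} (hP : IsProj J P)
    {N : (finPres.{max v w} (IsProj J).FullSubcategory).FullSubcategory}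
    {k k' : (projYoneda.{w} hE).obj P ⟶ N}
    (h : k.hom.app (.op ⟨P, hP⟩) ⟨𝟙 P⟩ = k'.hom.app (.op ⟨P, hP⟩) ⟨𝟙 P⟩) : k = k' := by
  ext ⟨R⟩ ⟨x⟩
  have hx : (⟨x⟩ : ULift (R.obj ⟶ P)) =
      act (projYonedaObj.{w} J P) (P := ⟨P, hP⟩) (ObjectProperty.homMk x) ⟨𝟙 P⟩ :=
    ULift.ext _ _ (Category.comp_id x).symm
  have key (l : (projYoneda.{w} hE).obj P ⟶ N) : l.hom.app (.op R) ⟨x⟩ =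
      act N.obj (P := ⟨P, hP⟩) (ObjectProperty.homMk x) (l.hom.app _ ⟨𝟙 P⟩) :=
    (congrArg (l.hom.app (.op R)) hx).trans (app_act l.hom _ _)
  rw [key, key, h]

lemma exists_projYoneda_hom (hE : EnoughProj J) {P : T} (hP : IsProj J P)
    {N : (finPres.{max v w} (IsProj J).FullSubcategory).FullSubcategory}
    (n : N.obj.obj (.op ⟨P, hP⟩)) :
    ∃ k : (projYoneda.{w} hE).obj P ⟶ N, k.hom.app (.op ⟨P, hP⟩) ⟨𝟙 P⟩ = n := by
  obtain ⟨r, rfl⟩ := (isPresentation N).gen n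
  refine ⟨ObjectProperty.homMk
    { app := fun R => AddCommGrpCat.ofHom
        { toFun := fun x => act N.obj (P := ⟨P, hP⟩) (ObjectProperty.homMk x.down) (act N.obj r _)
          map_zero' := ?_
          map_add' := fun x y => ?_ }
      naturality := fun R S s => ?_ }, act_id _ _⟩
  · rw [← act_comp]
    change act N.obj ((0 : R.unop ⟶ ⟨P, hP⟩) ≫ r) _ = 0
    rw [(isPresentation N).rel]
    exact ⟨0, by simp⟩
  · rw [← act_comp, ← act_comp, ← act_comp, ← (isPresentation N).add, ← Preadditive.add_comp]
    rfl
  · ext x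
    change act N.obj (P := ⟨P, hP⟩) (s.unop ≫ ObjectProperty.homMk x.down) _ =
      act N.obj s.unop (act N.obj (P := ⟨P, hP⟩) (ObjectProperty.homMk x.down) _)
    rw [act_comp]

variable {F}

/-- An exact endofunctor of the target of the universal functor that restricts to the identity
along it is the identity. The equivalent category `B` meets the size constraint in the universal
property. -/
lemma IsUniversal.nonempty_iso_id_of_equivalence (hF : IsUniversal.{w} J F) {B : Type (w + 1)}
    [Category.{w} B] (E : A ≌ B) (G : A ⥤ A)
    [PreservesFiniteLimits G] [PreservesFiniteColimits G] (e : F ⋙ G ≅ F) :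
    Nonempty (G ≅ 𝟭 A) := by
  let : Preadditive B := .ofFullyFaithful E.fullyFaithfulInverse
  have : HasFiniteLimits B :=
    ⟨fun _ => Adjunction.hasLimitsOfShape_of_equivalence E.inverse⟩
  let : Abelian B := abelianOfEquivalence E.inverse
  obtain ⟨i⟩ := hF.nonempty_iso (B := B) (G ⋙ E.functor) (𝟭 A ⋙ E.functor)
    ((Functor.associator _ _ _).symm ≪≫ Functor.isoWhiskerRight (e ≪≫ F.rightUnitor.symm) _ ≪≫
      Functor.associator _ _ _)
  exact ⟨NatIso.ofComponents (fun X => E.functor.preimageIso (i.app X))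
    (fun f => E.functor.map_injective (by simpa using i.hom.naturality f))⟩

lemma IsUniversal.nonempty_iso_id (hF : IsUniversal.{max u v u' v'} J F) (G : A ⥤ A)
    [PreservesFiniteLimits G] [PreservesFiniteColimits G] (e : F ⋙ G ≅ F) :
    Nonempty (G ≅ 𝟭 A) := by
  let : Category.{v'} (ULift.{(max u v u' v') + 1} A) :=
    uliftCategory.{v', u', (max u v u' v') + 1} A
  let E : A ≌ ULift.{(max u v u' v') + 1} A := ULift.equivalence.{v', u', (max u v u' v') + 1}
  exact hF.nonempty_iso_id_of_equivalence (E.trans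
    (ULiftHom.equiv.{v', (max u v u' v') + 1, max u v u' v'})) G e

/-- The universal functor is a projective approximation. The Yoneda functor `H` to finitely
presented presheaves on relative projective objects factors as `F ⋙ G`, and the extension `L` of
`F` to presheaves satisfies `G ⋙ L ≅ 𝟭 A`. So `G` is faithful, and all four properties are
inherited from those of `H` and `L`. -/
lemma IsUniversal.isProjectiveApproximation (hJ : IsStableHomologicalIdeal.{w₁, w₂} J)
    (hE : EnoughProj J) (hF : IsUniversal.{max u v u' v'} J F) :
    IsProjectiveApproximation J F := by
  have := hE.hasWeakKernels
  let H : T ⥤ (finPres.{max u v u' v'} (IsProj J).FullSubcategory).FullSubcategory :=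
    projYoneda.{max u v u' v'} hE
  have : H.IsHomological := projYoneda_isHomological hE
  obtain ⟨G, _, _, ⟨η⟩⟩ := hF.exists_exact_factorization hJ H
    fun _ _ => projYoneda_map_eq_zero hE
  let L : (finPres.{max u v u' v'} (IsProj J).FullSubcategory).FullSubcategory ⥤ A :=
    extFunctor ((IsProj J).ι ⋙ F)
  obtain ⟨_, _⟩ : PreservesFiniteLimits L ∧ PreservesFiniteColimits L :=
    extFunctor_preserves (mapsWeakKernelsToExact hE hF.map_eq_zero)
  obtain ⟨θ⟩ := hF.nonempty_iso_id (G ⋙ L) ((Functor.associator _ _ _).symm ≪≫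
    Functor.isoWhiskerRight η L ≪≫ projYonedaCompExt hE hF.map_eq_zero)
  have : G.Faithful := Functor.Faithful.of_comp_iso θ
  have hη {X Y : T} (f : X ⟶ Y) : G.map (F.map f) = η.hom.app X ≫ H.map f ≫ η.inv.app Y := by
    have := η.hom.naturality f
    dsimp at this
    rw [← reassoc_of% this]
    simp
  refine ⟨fun X Y f => ⟨fun hf => ?_, hF.map_eq_zero f⟩, fun P X hP h => ?_, fun P hP => ?_,
    fun M => ?_⟩
  · -- `f` vanishes on a relative projective cover of `X`, so it factors through a morphism in `J`.
    have hHf : H.map f = 0 := by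
      have := hη f
      rw [hf, G.map_zero] at this
      exact (cancel_mono (η.inv.app Y)).1 ((cancel_epi (η.hom.app X)).1 (by
        rw [← this, zero_comp, comp_zero]))
    obtain ⟨P, p, hP, Z, q, r, hT, hq⟩ := hE X
    have hpf : p ≫ f = 0 := congrArg ULift.down
      (ConcreteCategory.congr_hom (NatTrans.congr_app (congrArg (·.hom) hHf) (.op ⟨P, hP⟩)) ⟨p⟩)
    obtain ⟨g, rfl⟩ := Triangle.yoneda_exact₂ _ hT f hpf
    obtain ⟨C, _, _, _, _, H', _, _, h⟩ := hJ
    have hq' : H'.map q = 0 := (h _).1 hq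
    refine (h _).2 ?_
    exact (H'.map_comp _ _).trans ((congrArg (· ≫ H'.map g) hq').trans zero_comp)
  · let k : H.obj P ⟶ H.obj X := η.inv.app P ≫ G.map h ≫ η.hom.app X
    let g : P ⟶ X := ULift.down (k.hom.app (.op ⟨P, hP⟩) ⟨𝟙 P⟩)
    have hg : H.map g = k :=
      projYoneda_hom_ext.{max u v u' v'} hE hP (ULift.ext _ _ (Category.id_comp g))
    refine ⟨g, G.map_injective ?_⟩
    rw [hη, hg]
    simp [k]
  · -- `H P` is projective by the Yoneda Lemma; a lifting of `G f` is transported along `θ`.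
    constructor
    intro N M f q _
    have hS : (ShortComplex.mk (G.map q) (0 : G.obj M ⟶ G.obj M) (by simp)).Exact :=
      (ShortComplex.exact_iff_epi _ rfl).2 inferInstance
    rw [exact_finPres_iff] at hS
    obtain ⟨m, hm⟩ := hS ⟨P, hP⟩
      ((show H.obj P ⟶ _ from η.inv.app P ≫ G.map f).hom.app (.op ⟨P, hP⟩) ⟨𝟙 P⟩) rfl
    obtain ⟨k, hk⟩ := exists_projYoneda_hom.{max u v u' v'} hE hP m
    have hkq : k ≫ G.map q = η.inv.app P ≫ G.map f :=
      projYoneda_hom_ext.{max u v u' v'} hE hP (by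
        rw [← hm, ← hk]
        rfl)
    refine ⟨θ.inv.app _ ≫ L.map (η.hom.app P ≫ k) ≫ θ.hom.app N, ?_⟩
    have h₁ := θ.hom.naturality q
    have h₂ := θ.hom.naturality f
    dsimp at h₁ h₂
    rw [Category.assoc, Category.assoc, ← h₁, ← L.map_comp_assoc, Category.assoc, hkq,
      Iso.hom_inv_id_app_assoc, h₂, Iso.inv_hom_id_app_assoc]
  · refine ⟨(genObj (G.obj M)).obj, (genObj (G.obj M)).property,
      extπ ((IsProj J).ι ⋙ F) (G.obj M) ≫ θ.hom.app M, ?_⟩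
    exact epi_comp' (inferInstanceAs (Epi (extπ ((IsProj J).ι ⋙ F) (G.obj M))))
      (inferInstanceAs (Epi (θ.hom.app M)))

end Approximation
/-! ### Splitting idempotents -/

section Idempotents

variable {T : Type u} [Category.{v} T] [HasZeroObject T] [HasShift T ℤ] [Preadditive T]
  [∀ n : ℤ, (shiftFunctor T n).Additive] [Pretriangulated T]

/-- A retract in a pretriangulated category has a complement. -/
lemma exists_complement {X W : T} (s : X ⟶ W) (r : W ⟶ X) (h : s ≫ r = 𝟙 X) :
    ∃ (C : T) (i : C ⟶ W) (c : W ⟶ C), i ≫ c = 𝟙 C ∧ c ≫ i = 𝟙 W - r ≫ s := by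
  obtain ⟨C, c, d, hT⟩ := distinguished_cocone_triangle s
  have : Mono s := mono_of_mono_fac h
  have hd : d = 0 := Triangle.mor₃_eq_zero_of_mono₁ _ hT this
  have : Epi c := Triangle.epi₂ _ hT hd
  have hsc : s ≫ c = 0 := comp_distTriang_mor_zero₁₂ _ hT
  obtain ⟨i, hi⟩ : ∃ i : C ⟶ W, 𝟙 W - r ≫ s = c ≫ i :=
    Triangle.yoneda_exact₂ _ hT (𝟙 W - r ≫ s) (by
      change s ≫ (𝟙 W - r ≫ s) = 0
      rw [Preadditive.comp_sub, reassoc_of% h, Category.comp_id, sub_self])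
  refine ⟨C, i, c, ?_, hi.symm⟩
  rw [← cancel_epi c, ← Category.assoc, ← hi, Preadditive.sub_comp, Category.assoc, hsc]
  simp

/-- If a triangulated category has countable coproducts, then idempotents split. For an
idempotent `e` on `P`, the complement of the split monomorphism of `∐ P` over `ℕ` that shifts the
image of `e` and fixes the image of `1 - e` is an image of `e`. -/
instance [HasCountableCoproducts T] : IsIdempotentComplete T where
  idempotents_split P e he := by
    let s : ∐ (fun _ : ℕ => P) ⟶ ∐ (fun _ : ℕ => P) := Limits.Sigma.desc fun n =>
      e ≫ Limits.Sigma.ι (fun _ : ℕ => P) (n + 1) +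
        (𝟙 P - e) ≫ Limits.Sigma.ι (fun _ : ℕ => P) n
    let a (n : ℕ) : P ⟶ ∐ (fun _ : ℕ => P) :=
      n.casesOn 0 fun m => e ≫ Limits.Sigma.ι (fun _ : ℕ => P) m
    let r : ∐ (fun _ : ℕ => P) ⟶ ∐ (fun _ : ℕ => P) := Limits.Sigma.desc fun n =>
      a n + (𝟙 P - e) ≫ Limits.Sigma.ι (fun _ : ℕ => P) n
    have he' : e ≫ (𝟙 P - e) = 0 := by rw [Preadditive.comp_sub, he, Category.comp_id, sub_self]
    have he'' : (𝟙 P - e) ≫ e = 0 := by rw [Preadditive.sub_comp, he, Category.id_comp, sub_self]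
    have he''' : (𝟙 P - e) ≫ (𝟙 P - e) = 𝟙 P - e := by
      rw [Preadditive.comp_sub, he'', Category.comp_id, sub_zero]
    have hs (n : ℕ) : Limits.Sigma.ι (fun _ : ℕ => P) n ≫ s =
        e ≫ Limits.Sigma.ι (fun _ : ℕ => P) (n + 1) +
          (𝟙 P - e) ≫ Limits.Sigma.ι (fun _ : ℕ => P) n := Limits.Sigma.ι_desc _ _
    have hr (n : ℕ) : Limits.Sigma.ι (fun _ : ℕ => P) n ≫ r =
        a n + (𝟙 P - e) ≫ Limits.Sigma.ι (fun _ : ℕ => P) n := Limits.Sigma.ι_desc _ _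
    have ha (n : ℕ) : a (n + 1) = e ≫ Limits.Sigma.ι (fun _ : ℕ => P) n := rfl
    have hae (n : ℕ) : (𝟙 P - e) ≫ a n = 0 := by
      cases n with
      | zero => exact comp_zero
      | succ m => rw [ha, reassoc_of% he'', zero_comp]
    have hsr : s ≫ r = 𝟙 _ := by
      refine Limits.Sigma.hom_ext _ _ fun n => ?_
      rw [reassoc_of% hs n, Preadditive.add_comp, Category.assoc, Category.assoc, hr, hr, ha,
        Preadditive.comp_add, Preadditive.comp_add, reassoc_of% he, reassoc_of% he',
        reassoc_of% he''', hae, zero_comp, add_zero, zero_add, ← Preadditive.add_comp,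
        add_sub_cancel, Category.id_comp, Category.comp_id]
    obtain ⟨C, i, c, hic, hci⟩ := exists_complement s r hsr
    let π : ∐ (fun _ : ℕ => P) ⟶ P := Limits.Sigma.desc fun n => n.casesOn (𝟙 P) fun _ => 0
    have hπ₀ : Limits.Sigma.ι (fun _ : ℕ => P) 0 ≫ π = 𝟙 P := Limits.Sigma.ι_desc _ _
    have hπ₁ (n : ℕ) : Limits.Sigma.ι (fun _ : ℕ => P) (n + 1) ≫ π = 0 := Limits.Sigma.ι_desc _ _
    have has (n : ℕ) : a n ≫ s = n.casesOn 0 fun m =>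
        e ≫ Limits.Sigma.ι (fun _ : ℕ => P) (m + 1) := by
      cases n with
      | zero => exact zero_comp
      | succ m => rw [ha, Category.assoc, hs, Preadditive.comp_add, reassoc_of% he,
          reassoc_of% he', zero_comp, add_zero]
    have hci' : c ≫ i = π ≫ e ≫ Limits.Sigma.ι (fun _ : ℕ => P) 0 := by
      refine Limits.Sigma.hom_ext _ _ fun n => ?_
      rw [hci, Preadditive.comp_sub, reassoc_of% hr n, Preadditive.add_comp, has, Category.assoc,
        hs, Preadditive.comp_add, reassoc_of% he'', reassoc_of% he''', zero_comp, zero_add,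
        Category.comp_id]
      cases n with
      | zero =>
        rw [reassoc_of% hπ₀, Preadditive.sub_comp, Category.id_comp]
        change _ - (0 + _) = _
        abel
      | succ m =>
        rw [reassoc_of% hπ₁ m, zero_comp, Preadditive.sub_comp, Category.id_comp]
        abel
    refine ⟨C, i ≫ π, Limits.Sigma.ι (fun _ : ℕ => P) 0 ≫ c, ?_, ?_⟩
    · have : IsSplitEpi c := ⟨⟨i, hic⟩⟩
      have : IsSplitMono i := ⟨⟨c, hic⟩⟩
      rw [← cancel_epi c, ← cancel_mono i]
      simp only [Category.assoc, hci', reassoc_of% hci', reassoc_of% hπ₀, Category.comp_id]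
      rw [reassoc_of% he]
    · rw [Category.assoc, reassoc_of% hci', reassoc_of% hπ₀, hπ₀, Category.comp_id]

end Idempotents

/-! ### Objects without morphisms to contractible objects -/

section Orthogonal

variable {T : Type u} [Category.{v} T] [HasZeroObject T] [HasShift T ℤ] [Preadditive T]
  [∀ n : ℤ, (shiftFunctor T n).Additive] [Pretriangulated T] {J : MorphismProperty T}
  {A : Type u'} [Category.{v'} A] [Abelian A] [HasShift A ℤ]
  [∀ n : ℤ, (shiftFunctor A n).Additive]
  {F : T ⥤ A} [F.CommShift ℤ] [F.IsHomological]

/-- A distinguished triangle whose third morphism is annihilated by a homological functor gives a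
short exact sequence. -/
lemma shortExact_of_map_eq_zero {X Y Z : T} {f : X ⟶ Y} {g : Y ⟶ Z} {k : Z ⟶ X⟦(1 : ℤ)⟧}
    (hT : Triangle.mk f g k ∈ distTriang T) (hk : F.map k = 0) (w : F.map f ≫ F.map g = 0) :
    (ShortComplex.mk (F.map f) (F.map g) w).ShortExact := by
  have h₂ : (ShortComplex.mk (F.map f) (F.map g) w).Exact := F.map_distinguished_exact _ hT
  have h₃ : (ShortComplex.mk (F.map g) (F.map k) (by rw [hk, comp_zero])).Exact :=
    F.map_distinguished_exact _ (rot_of_distTriang _ hT)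
  have h₁ := F.map_distinguished_exact _ (inv_rot_of_distTriang _ hT)
  refine ShortComplex.ShortExact.mk' h₂ ?_ ?_
  · refine (ShortComplex.exact_iff_mono _ ?_).1 h₁
    have hk' : F.map (k⟦(-1 : ℤ)⟧') = 0 := by
      rw [← cancel_mono ((F.commShiftIso (-1 : ℤ)).hom.app _)]
      have := (F.commShiftIso (-1 : ℤ)).hom.naturality k
      dsimp at this
      rw [this, hk, Functor.map_zero, comp_zero, zero_comp]
    have (Y : T) (i : X⟦(1 : ℤ)⟧⟦(-1 : ℤ)⟧ ⟶ Y) : F.map (-k⟦(-1 : ℤ)⟧' ≫ i) = 0 := by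
      rw [F.map_neg, F.map_comp, hk', zero_comp, neg_zero]
    exact this _ _
  · exact (ShortComplex.exact_iff_epi _ hk).1 h₃

lemma map_mor₃_eq_zero_of_epi {X Y Z : T} {f : X ⟶ Y} {g : Y ⟶ Z} {k : Z ⟶ X⟦(1 : ℤ)⟧}
    (hT : Triangle.mk f g k ∈ distTriang T) [Epi (F.map g)] : F.map k = 0 := by
  have : g ≫ k = 0 := comp_distTriang_mor_zero₂₃ _ hT
  rw [← cancel_epi (F.map g), ← F.map_comp, this, F.map_zero, comp_zero]

lemma isOrth_eq_leftOrthogonal : IsOrth J = (IsContractible J).leftOrthogonal := by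
  ext X
  exact ⟨fun hX B f hB => hX hB f, fun hX B hB f => hX f hB⟩

lemma IsProj.isOrth {P : T} (hP : IsProj J P) : IsOrth J P := fun B hB f => by
  simpa using hP (𝟙 B) hB f

namespace IsProjectiveApproximation

variable (h : IsProjectiveApproximation J F)
include h

lemma isContractible_iff {B : T} : IsContractible J B ↔ IsZero (F.obj B) := by
  rw [IsContractible, ← h.map_eq_zero_iff, CategoryTheory.Functor.map_id, IsZero.iff_id_eq_zero]

lemma isTriangulated_isOrth : (IsOrth J).IsTriangulated := by
  have : (IsContractible J).IsStableUnderShift ℤ := ⟨fun n => ⟨fun B hB =>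
    h.isContractible_iff.2 (IsZero.of_iso
      ((shiftFunctor A n).map_isZero (h.isContractible_iff.1 hB)) ((F.commShiftIso n).app B))⟩⟩
  rw [isOrth_eq_leftOrthogonal]
  infer_instance

lemma isClosedUnderIsomorphisms_isOrth : (IsOrth J).IsClosedUnderIsomorphisms := by
  rw [isOrth_eq_leftOrthogonal]
  infer_instance

/-- Objects without morphisms to contractible objects are local for the functor: it reflects
isomorphisms between them. -/
lemma isIso_of_isIso_map {X Y : T} (hX : IsOrth J X) (hY : IsOrth J Y) (f : X ⟶ Y)
    [IsIso (F.map f)] : IsIso f := by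
  have := h.isTriangulated_isOrth
  have := h.isClosedUnderIsomorphisms_isOrth
  obtain ⟨C, g, k, hT⟩ := distinguished_cocone_triangle f
  have hC : IsOrth J C := (IsOrth J).ext_of_isTriangulatedClosed₃ _ hT hX hY
  have hg : F.map g = 0 := by
    have : f ≫ g = 0 := comp_distTriang_mor_zero₁₂ _ hT
    rw [← cancel_epi (F.map f), ← F.map_comp, this, F.map_zero, comp_zero]
  have hk : F.map k = 0 := by
    have : k ≫ f⟦(1 : ℤ)⟧' = 0 := comp_distTriang_mor_zero₃₁ _ hT
    have hF := (F.commShiftIso (1 : ℤ)).hom.naturality f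
    dsimp at hF
    have : IsIso (F.map (f⟦(1 : ℤ)⟧')) := by
      rw [← isIso_comp_right_iff _ ((F.commShiftIso (1 : ℤ)).hom.app Y), hF]
      infer_instance
    rw [← cancel_mono (F.map (f⟦(1 : ℤ)⟧')), ← F.map_comp, ‹k ≫ _ = 0›, F.map_zero, zero_comp]
  have hFC : IsZero (F.obj C) :=
    ShortComplex.Exact.isZero_of_both_zeros
      (F.map_distinguished_exact _ (rot_of_distTriang _ hT)) hg hk
  exact (Triangle.isZero₃_iff_isIso₁ _ hT).1
    ((IsZero.iff_id_eq_zero _).2 (hC (h.isContractible_iff.2 hFC) (𝟙 C)))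

lemma eq_zero_of_isProj {P X : T} (hP : IsProj J P) (f : P ⟶ X) (hf : F.map f = 0) : f = 0 := by
  simpa using hP f ((h.map_eq_zero_iff f).1 hf) (𝟙 P)

lemma eq_of_isProj {P X : T} (hP : IsProj J P) {f g : P ⟶ X} (hf : F.map f = F.map g) :
    f = g :=
  sub_eq_zero.1 (h.eq_zero_of_isProj hP _ (by rw [F.map_sub, hf, sub_self]))

/-- Projective objects of the target are images of relative projective objects. -/
lemma exists_isProj_iso [IsIdempotentComplete T] (Q : A) [Projective Q] :
    ∃ (P : T) (_ : IsProj J P), Nonempty (F.obj P ≅ Q) := by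
  obtain ⟨P, hP, p, _⟩ := h.exists_epi Q
  have hs : Projective.factorThru (𝟙 Q) p ≫ p = 𝟙 Q := Projective.factorThru_comp _ _
  obtain ⟨e, he⟩ := h.exists_map_eq hP (p ≫ Projective.factorThru (𝟙 Q) p)
  obtain ⟨R, i, c, hic, hci⟩ := IsIdempotentComplete.idempotents_split P e
    (h.eq_of_isProj hP (by simp [he, reassoc_of% hs]))
  have hR : F.map i ≫ F.map c = 𝟙 _ := by rw [← F.map_comp, hic, CategoryTheory.Functor.map_id]
  have hR' : F.map c ≫ F.map i = p ≫ Projective.factorThru (𝟙 Q) p := by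
    rw [← F.map_comp, hci, he]
  refine ⟨R, hP.of_retract i c hic,
    ⟨⟨F.map i ≫ p, Projective.factorThru (𝟙 Q) p ≫ F.map c, ?_, ?_⟩⟩⟩
  · rw [Category.assoc, ← reassoc_of% hR', hR, Category.comp_id, hR]
  · rw [Category.assoc, reassoc_of% hR', hs, Category.comp_id, hs]

lemma isProj_of_projective [IsIdempotentComplete T] {X : T} (hX : IsOrth J X)
    [Projective (F.obj X)] : IsProj J X := by
  obtain ⟨P, hP, ⟨e⟩⟩ := h.exists_isProj_iso (F.obj X)
  obtain ⟨f, hf⟩ := h.exists_map_eq hP e.hom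
  have : IsIso (F.map f) := by rw [hf]; infer_instance
  have := h.isIso_of_isIso_map hP.isOrth hX f
  exact hP.of_retract (inv f) f (by simp)

/-- Every object is covered by a relative projective object. -/
lemma exists_cover (X : T) : ∃ (P : T) (_ : IsProj J P) (π : P ⟶ X), Epi (F.map π) := by
  obtain ⟨P, hP, p, hp⟩ := h.exists_epi (F.obj X)
  obtain ⟨π, rfl⟩ := h.exists_map_eq hP p
  exact ⟨P, hP, π, hp⟩

end IsProjectiveApproximation

end Orthogonal

/-! ### Covers by relative projective objects -/

section Cover

variable {T : Type u} [Category.{v} T] [HasZeroObject T] [HasShift T ℤ] [Preadditive T]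
  [∀ n : ℤ, (shiftFunctor T n).Additive] [Pretriangulated T] {J : MorphismProperty T}
  {A : Type u'} [Category.{v'} A] [Abelian A] [HasShift A ℤ]
  [∀ n : ℤ, (shiftFunctor A n).Additive]
  {F : T ⥤ A} [F.CommShift ℤ] [F.IsHomological]

/-- A distinguished triangle `D ⟶ P ⟶ X ⟶ D⟦1⟧` is a *cover* of `X` if `P` is relatively
projective and `F(P) ⟶ F(X)` is an epimorphism. -/
structure IsCover (J : MorphismProperty T) (F : T ⥤ A) {D P X : T} (φ : D ⟶ P) (π : P ⟶ X)
    (κ : X ⟶ D⟦(1 : ℤ)⟧) : Prop where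
  dist : Triangle.mk φ π κ ∈ distTriang T
  isProj : IsProj J P
  epi : Epi (F.map π)

namespace IsCover

variable {D P X : T} {φ : D ⟶ P} {π : P ⟶ X} {κ : X ⟶ D⟦(1 : ℤ)⟧} (hc : IsCover J F φ π κ)
include hc

lemma comp_eq_zero : φ ≫ π = 0 := comp_distTriang_mor_zero₁₂ _ hc.dist

lemma map_comp_map : F.map φ ≫ F.map π = 0 := by
  rw [← F.map_comp, hc.comp_eq_zero, F.map_zero]

lemma map_eq_zero : F.map κ = 0 :=
  have := hc.epi
  map_mor₃_eq_zero_of_epi hc.dist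

lemma shortExact : (ShortComplex.mk (F.map φ) (F.map π) hc.map_comp_map).ShortExact :=
  shortExact_of_map_eq_zero hc.dist hc.map_eq_zero _

lemma isOrth (h : IsProjectiveApproximation J F) (hX : IsOrth J X) : IsOrth J D := by
  have := h.isTriangulated_isOrth
  have := h.isClosedUnderIsomorphisms_isOrth
  exact (IsOrth J).ext_of_isTriangulatedClosed₁ _ hc.dist hc.isProj.isOrth hX

lemma hasProjectiveDimensionLT (h : IsProjectiveApproximation J F) (n : ℕ)
    [hX : HasProjectiveDimensionLT (F.obj X) (n + 2)] :
    HasProjectiveDimensionLT (F.obj D) (n + 1) :=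
  (hc.shortExact.hasProjectiveDimensionLT_X₃_iff n (h.projective hc.isProj)).1 hX

lemma exists_desc {Y : T} (g : P ⟶ Y) (hg : φ ≫ g = 0) : ∃ u : X ⟶ Y, π ≫ u = g := by
  obtain ⟨u, hu⟩ := Triangle.yoneda_exact₂ _ hc.dist g hg
  exact ⟨u, hu.symm⟩

end IsCover

namespace IsProjectiveApproximation

variable (h : IsProjectiveApproximation J F)
include h

lemma exists_isCover (X : T) : ∃ (D P : T) (φ : D ⟶ P) (π : P ⟶ X) (κ : X ⟶ D⟦(1 : ℤ)⟧),
    IsCover J F φ π κ := by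
  obtain ⟨P, hP, π, hπ⟩ := h.exists_cover X
  obtain ⟨D, φ, κ, hT⟩ := distinguished_cocone_triangle₁ π
  exact ⟨D, P, φ, π, κ, hT, hP, hπ⟩

lemma exists_isCover_hom {D P X D' P' X' : T} {φ : D ⟶ P} {π : P ⟶ X} {κ : X ⟶ D⟦(1 : ℤ)⟧}
    {φ' : D' ⟶ P'} {π' : P' ⟶ X'} {κ' : X' ⟶ D'⟦(1 : ℤ)⟧} (hc : IsCover J F φ π κ)
    (hc' : IsCover J F φ' π' κ') (u : X ⟶ X') :
    ∃ (t : D ⟶ D') (w : P ⟶ P'), φ ≫ w = t ≫ φ' ∧ π ≫ u = w ≫ π' ∧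
      κ ≫ t⟦(1 : ℤ)⟧' = u ≫ κ' := by
  have := hc'.epi
  have := h.projective hc.isProj
  obtain ⟨w, hw⟩ := h.exists_map_eq hc.isProj (Projective.factorThru (F.map (π ≫ u)) (F.map π'))
  have hw' : π ≫ u = w ≫ π' := h.eq_of_isProj hc.isProj (by
    rw [F.map_comp w, hw, Projective.factorThru_comp])
  obtain ⟨t, ht, ht'⟩ :=
    complete_distinguished_triangle_morphism₁ _ _ hc.dist hc'.dist w u hw'
  exact ⟨t, w, ht, hw', ht'⟩

/-- An object without morphisms to contractible objects whose image has finite projective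
dimension is built from relative projective objects in finitely many steps. -/
lemma prop_of_hasProjectiveDimensionLT [IsIdempotentComplete T] (Q : ObjectProperty T)
    [Q.IsClosedUnderIsomorphisms] [Q.IsTriangulated] (hQ : IsProj J ≤ Q) (n : ℕ) {X : T}
    (hX : IsOrth J X) [HasProjectiveDimensionLT (F.obj X) (n + 1)] : Q X := by
  induction n generalizing X with
  | zero =>
    have : Projective (F.obj X) := projective_iff_hasProjectiveDimensionLT_one.2 ‹_›
    exact hQ _ (h.isProj_of_projective hX)
  | succ n hn =>
    obtain ⟨D, P, φ, π, κ, hc⟩ := h.exists_isCover X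
    have hD : Q D :=
      have := hc.hasProjectiveDimensionLT h n
      hn (hc.isOrth h hX)
    exact Q.ext_of_isTriangulatedClosed₃ _ hc.dist hD (hQ _ hc.isProj)

/-- In finite global dimension, the localising subcategory generated by the relative projective
objects consists of the objects without morphisms to contractible objects. -/
lemma loc_iff_isOrth [IsIdempotentComplete T] (n : ℕ)
    (hA : ∀ M : A, HasProjectiveDimensionLT M (n + 1)) {X : T} : Loc J X ↔ IsOrth J X := by
  constructor
  · intro hX
    refine hX _ h.isClosedUnderIsomorphisms_isOrth h.isTriangulated_isOrth ?_
      fun P hP => IsProj.isOrth hP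
    refine fun ι _ => ⟨?_⟩
    rintro Y ⟨p⟩ B hB f
    exact p.isColimit.hom_ext fun i => (p.prop_diag_obj i hB _).trans comp_zero.symm
  · intro hX Q _ _ _ hQ
    exact h.prop_of_hasProjectiveDimensionLT Q hQ n hX

end IsProjectiveApproximation

end Cover

/-! ### Extension classes -/

section ExtensionClass

variable {A : Type u'} [Category.{v'} A] [Abelian A] [HasExt.{w} A]

/-- The class in `Ext¹(Z, X)` of an extension `X ⟶ Y ⟶ Z`. -/
noncomputable def extCls {X Y Z : A} {f : X ⟶ Y} {g : Y ⟶ Z} {zero : f ≫ g = 0}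
    (hS : (ShortComplex.mk f g zero).ShortExact) : Ext.{w} Z X 1 := hS.extClass

lemma extCls_naturality {X Y Z X' Y' Z' : A} {f : X ⟶ Y} {g : Y ⟶ Z} {zero : f ≫ g = 0}
    {f' : X' ⟶ Y'} {g' : Y' ⟶ Z'} {zero' : f' ≫ g' = 0}
    (hS : (ShortComplex.mk f g zero).ShortExact) (hS' : (ShortComplex.mk f' g' zero').ShortExact)
    {a : X ⟶ X'} {b : Y ⟶ Y'} {c : Z ⟶ Z'} (h₁ : a ≫ f' = f ≫ b) (h₂ : b ≫ g' = g ≫ c) :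
    (extCls.{w} hS).comp (Ext.mk₀ a) (add_zero 1) =
      (Ext.mk₀ c).comp (extCls hS') (zero_add 1) :=
  ShortComplex.ShortExact.extClass_naturality hS hS' ⟨a, b, c, h₁, h₂⟩

/-- Every class in `Extᵐ(Z, W)` is divisible by the class of the extension if `Extᵐ(Y, W) = 0`. -/
lemma exists_extCls_comp_eq {X Y Z W : A} {f : X ⟶ Y} {g : Y ⟶ Z} {zero : f ≫ g = 0}
    (hS : (ShortComplex.mk f g zero).ShortExact) {n m : ℕ} (hn : 1 + n = m)
    [HasProjectiveDimensionLT Y m] (e : Ext.{w} Z W m) :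
    ∃ x : Ext.{w} X W n, (extCls hS).comp x hn = e :=
  Ext.contravariant_sequence_exact₃ hS W e (Ext.eq_zero_of_hasProjectiveDimensionLT _ m le_rfl) hn

lemma eq_zero_of_extCls_comp_eq_zero {X Y Z W : A} {f : X ⟶ Y} {g : Y ⟶ Z} {zero : f ≫ g = 0}
    (hS : (ShortComplex.mk f g zero).ShortExact) {n m : ℕ} (hn : 1 + n = m)
    [HasProjectiveDimensionLT Y n] {x : Ext.{w} X W n} (hx : (extCls hS).comp x hn = 0) :
    x = 0 := by
  obtain ⟨y, rfl⟩ := Ext.contravariant_sequence_exact₁ hS W x hn hx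
  rw [Ext.eq_zero_of_hasProjectiveDimensionLT y n le_rfl, Ext.comp_zero]

/-- An extension with trivial class splits. -/
lemma exists_section_of_extCls_eq_zero {X Y Z : A} {f : X ⟶ Y} {g : Y ⟶ Z} {zero : f ≫ g = 0}
    (hS : (ShortComplex.mk f g zero).ShortExact) (hx : extCls.{w} hS = 0) :
    ∃ s : Z ⟶ Y, s ≫ g = 𝟙 Z := by
  obtain ⟨y, hy⟩ := Ext.covariant_sequence_exact₃ Z hS (Ext.mk₀ (𝟙 Z)) (zero_add 1) (by
    change (Ext.mk₀ (𝟙 Z)).comp (extCls hS) _ = 0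
    rw [hx, Ext.comp_zero])
  obtain ⟨s, rfl⟩ := Ext.homEquiv₀.symm.surjective y
  refine ⟨s, Ext.homEquiv₀.symm.injective ?_⟩
  change Ext.mk₀ _ = Ext.mk₀ _
  rw [← hy]
  exact (Ext.mk₀_comp_mk₀ s g).symm

lemma comp_mk₀_injective_of_isIso {X Y Z : A} {n : ℕ} (i : Y ⟶ Z) [IsIso i] {x y : Ext.{w} X Y n}
    (hxy : x.comp (Ext.mk₀ i) (add_zero n) = y.comp (Ext.mk₀ i) (add_zero n)) : x = y := by
  have := congrArg (fun z => z.comp (Ext.mk₀ (inv i)) (add_zero n)) hxy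
  simpa [Ext.comp_assoc_of_second_deg_zero] using this

lemma mk₀_comp_injective_of_isIso {X Y Z : A} {n : ℕ} (i : X ⟶ Y) [IsIso i] {x y : Ext.{w} Y Z n}
    (hxy : (Ext.mk₀ i).comp x (zero_add n) = (Ext.mk₀ i).comp y (zero_add n)) : x = y := by
  have := congrArg (fun z => (Ext.mk₀ (inv i)).comp z (zero_add n)) hxy
  simpa using this

end ExtensionClass

/-! ### The Universal Coefficient Theorem -/

section UCT

variable {T : Type u} [Category.{v} T] [HasZeroObject T] [HasShift T ℤ] [Preadditive T]
  [∀ n : ℤ, (shiftFunctor T n).Additive] [Pretriangulated T] {J : MorphismProperty T}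
  {A : Type u'} [Category.{v'} A] [Abelian A] [HasShift A ℤ]
  [∀ n : ℤ, (shiftFunctor A n).Additive]
  {F : T ⥤ A} [F.CommShift ℤ] [F.IsHomological]

namespace IsProjectiveApproximation

variable (h : IsProjectiveApproximation J F)
include h

variable [IsIdempotentComplete T] {D : T} (hD : IsOrth J D)
  [HasProjectiveDimensionLT (F.obj D) 2]
include hD

lemma exists_isCover_isProj : ∃ (P₂ P₁ : T) (φ : P₂ ⟶ P₁) (π : P₁ ⟶ D) (κ : D ⟶ P₂⟦(1 : ℤ)⟧),
    IsCover J F φ π κ ∧ IsProj J P₂ := by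
  obtain ⟨P₂, P₁, φ, π, κ, hc⟩ := h.exists_isCover D
  have : Projective (F.obj P₂) :=
    projective_iff_hasProjectiveDimensionLT_one.2 (hc.hasProjectiveDimensionLT h 0)
  exact ⟨P₂, P₁, φ, π, κ, hc, h.isProj_of_projective (hc.isOrth h hD)⟩

/-- The surjectivity of `T(D, Y) ⟶ Hom(F(D), F(Y))` in the Universal Coefficient Theorem. -/
lemma exists_lift {Y : T} (q : F.obj D ⟶ F.obj Y) : ∃ u : D ⟶ Y, F.map u = q := by
  obtain ⟨P₂, P₁, φ, π, κ, hc, hP⟩ := h.exists_isCover_isProj hD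
  obtain ⟨g, hg⟩ := h.exists_map_eq hc.isProj (F.map π ≫ q)
  obtain ⟨u, rfl⟩ := hc.exists_desc g (h.eq_zero_of_isProj hP _ (by
    rw [F.map_comp, hg, reassoc_of% hc.map_comp_map, zero_comp]))
  have := hc.epi
  exact ⟨u, by rw [← cancel_epi (F.map π), ← F.map_comp, hg]⟩

end IsProjectiveApproximation

variable [HasExt.{w} A]

lemma exists_isUCTClass {D B : T} (f : D ⟶ B) (hf : F.map f = 0) :
    ∃ x : Ext.{w} (F.obj D) ((F.obj B)⟦(-1 : ℤ)⟧) 1, IsUCTClass F f x := by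
  obtain ⟨E, a, b, hT⟩ := distinguished_cocone_triangle₂
    (f ≫ (shiftFunctorCompIsoId T (-1 : ℤ) 1 (by norm_num)).inv.app B)
  have h0 : F.map a ≫ F.map b = 0 := by
    have : a ≫ b = 0 := comp_distTriang_mor_zero₁₂ _ hT
    rw [← F.map_comp, this, F.map_zero]
  have hS := shortExact_of_map_eq_zero (F := F) hT (by rw [F.map_comp, hf, zero_comp]) h0
  exact ⟨_, E, a, b, _, hT, by simp, h0, hS, rfl⟩

/-- If `X ⟶ E ⟶ D ⟶ X⟦1⟧` is a distinguished triangle and `D ⟶ X⟦1⟧ ⟶ B` factors as `g ≫ f`,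
then the class of `F(X) ⟶ F(E) ⟶ F(D)` and the class of `f` agree in `Ext¹(F(D), F(B)[-1])`. -/
lemma IsUCTClass.extCls_comp {X E D' D B : T} {φ : X ⟶ E} {π : E ⟶ D'} {κ : D' ⟶ X⟦(1 : ℤ)⟧}
    (hT : Triangle.mk φ π κ ∈ distTriang T) {zero : F.map φ ≫ F.map π = 0}
    (hS : (ShortComplex.mk (F.map φ) (F.map π) zero).ShortExact) {f : D ⟶ B}
    {x : Ext.{w} (F.obj D) ((F.obj B)⟦(-1 : ℤ)⟧) 1} (hx : IsUCTClass F f x) (g : D' ⟶ D)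
    (y : X ⟶ B⟦(-1 : ℤ)⟧)
    (comm : κ ≫ y⟦(1 : ℤ)⟧' ≫ (shiftFunctorCompIsoId T (-1 : ℤ) 1 (by norm_num)).hom.app B =
      g ≫ f) :
    (extCls hS).comp (Ext.mk₀ (F.map y ≫ (F.commShiftIso (-1 : ℤ)).hom.app B)) (add_zero 1) =
      (Ext.mk₀ (F.map g)).comp x (zero_add 1) := by
  obtain ⟨E', a, b, c, hT', rfl, h0, hS', rfl⟩ := hx
  have comm' : κ ≫ y⟦(1 : ℤ)⟧' = g ≫ c := by
    rw [← cancel_mono ((shiftFunctorCompIsoId T (-1 : ℤ) 1 (by norm_num)).hom.app B)]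
    simpa using comm
  obtain ⟨m, hm₁, hm₂⟩ : ∃ m : E ⟶ E', φ ≫ m = y ≫ a ∧ π ≫ g = m ≫ b :=
    complete_distinguished_triangle_morphism₂ _ _ hT hT' y g comm'
  have := extCls_naturality.{w} hS hS' (a := F.map y) (b := F.map m) (c := F.map g)
    (by rw [← F.map_comp, ← F.map_comp, hm₁]) (by rw [← F.map_comp, ← F.map_comp, hm₂])
  change _ = (Ext.mk₀ (F.map g)).comp ((extCls hS').comp _ _) _
  rw [← Ext.mk₀_comp_mk₀, ← Ext.comp_assoc_of_third_deg_zero, this,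
    Ext.comp_assoc_of_third_deg_zero]

namespace IsUCTClass

lemma naturality {D B D' B' : T} {f : D ⟶ B} {f' : D' ⟶ B'}
    {x : Ext.{w} (F.obj D) ((F.obj B)⟦(-1 : ℤ)⟧) 1}
    {x' : Ext.{w} (F.obj D') ((F.obj B')⟦(-1 : ℤ)⟧) 1}
    (hx : IsUCTClass F f x) (hx' : IsUCTClass F f' x') (g : D ⟶ D') (k : B ⟶ B')
    (comm : f ≫ k = g ≫ f') :
    x.comp (Ext.mk₀ ((F.map k)⟦(-1 : ℤ)⟧')) (add_zero 1) =
      (Ext.mk₀ (F.map g)).comp x' (zero_add 1) := by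
  obtain ⟨E, a, b, c, hT, rfl, h0, hS, rfl⟩ := hx
  have h₁ := (shiftFunctorCompIsoId T (-1 : ℤ) 1 (by norm_num)).hom.naturality k
  have h₂ := (F.commShiftIso (-1 : ℤ)).hom.naturality k
  dsimp at h₁ h₂
  have := hx'.extCls_comp hT hS g (k⟦(-1 : ℤ)⟧') (by
    rw [h₁, ← comm, Category.assoc])
  rw [← this, h₂, ← Ext.mk₀_comp_mk₀, ← Ext.comp_assoc_of_third_deg_zero]
  rfl

lemma eq {D B : T} {f : D ⟶ B} {x x' : Ext.{w} (F.obj D) ((F.obj B)⟦(-1 : ℤ)⟧) 1}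
    (hx : IsUCTClass F f x) (hx' : IsUCTClass F f x') : x = x' := by
  simpa using hx.naturality hx' (𝟙 D) (𝟙 B) (by simp)

lemma map_eq_zero {D B : T} {f : D ⟶ B} {x : Ext.{w} (F.obj D) ((F.obj B)⟦(-1 : ℤ)⟧) 1}
    (hx : IsUCTClass F f x) : F.map f = 0 := by
  obtain ⟨E, a, b, c, hT, rfl, h0, hS, -⟩ := hx
  have : Epi (F.map b) := hS.epi_g
  rw [F.map_comp, map_mor₃_eq_zero_of_epi (F := F) hT, zero_comp]

lemma precomp {D' D B : T} {f : D ⟶ B} {x : Ext.{w} (F.obj D) ((F.obj B)⟦(-1 : ℤ)⟧) 1}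
    (hx : IsUCTClass F f x) (g : D' ⟶ D) :
    IsUCTClass F (g ≫ f) ((Ext.mk₀ (F.map g)).comp x (zero_add 1)) := by
  obtain ⟨y, hy⟩ := exists_isUCTClass (F := F) (g ≫ f) (by rw [F.map_comp, hx.map_eq_zero, comp_zero])
  have := hy.naturality hx g (𝟙 B) (by simp)
  rw [CategoryTheory.Functor.map_id, CategoryTheory.Functor.map_id, Ext.comp_mk₀_id] at this
  rwa [← this]

lemma postcomp {D B B' : T} {f : D ⟶ B} {x : Ext.{w} (F.obj D) ((F.obj B)⟦(-1 : ℤ)⟧) 1}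
    (hx : IsUCTClass F f x) (k : B ⟶ B') :
    IsUCTClass F (f ≫ k) (x.comp (Ext.mk₀ ((F.map k)⟦(-1 : ℤ)⟧')) (add_zero 1)) := by
  obtain ⟨y, hy⟩ := exists_isUCTClass (F := F) (f ≫ k) (by rw [F.map_comp, hx.map_eq_zero, zero_comp])
  have := hx.naturality hy (𝟙 D) k (by simp)
  rw [CategoryTheory.Functor.map_id, Ext.mk₀_id_comp] at this
  rwa [this]

lemma add {D B : T} {f f' : D ⟶ B} {x x' : Ext.{w} (F.obj D) ((F.obj B)⟦(-1 : ℤ)⟧) 1}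
    (hx : IsUCTClass F f x) (hx' : IsUCTClass F f' x') : IsUCTClass F (f + f') (x + x') := by
  obtain ⟨y, hy⟩ := exists_isUCTClass (F := F) (f ≫ biprod.inl + f' ≫ biprod.inr : D ⟶ B ⊞ B)
    (by rw [F.map_add, F.map_comp, F.map_comp, hx.map_eq_zero, hx'.map_eq_zero]; simp)
  have h₁ := (hy.postcomp (biprod.fst : B ⊞ B ⟶ B)).eq (by simpa using hx)
  have h₂ := (hy.postcomp (biprod.snd : B ⊞ B ⟶ B)).eq (by simpa using hx')
  have h₃ := hy.postcomp (biprod.fst + biprod.snd : B ⊞ B ⟶ B)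
  rw [F.map_add, Functor.map_add, Ext.mk₀_add, Ext.comp_add, h₁, h₂] at h₃
  simpa using h₃

end IsUCTClass

lemma isUCTClass_zero (D B : T) :
    IsUCTClass F (0 : D ⟶ B) (0 : Ext.{w} (F.obj D) ((F.obj B)⟦(-1 : ℤ)⟧) 1) := by
  obtain ⟨x, hx⟩ := exists_isUCTClass.{w} (F := F) (0 : D ⟶ B) (F.map_zero _ _)
  have := hx.postcomp (0 : B ⟶ B)
  rwa [F.map_zero, Functor.map_zero, Ext.mk₀_zero, Ext.comp_zero, zero_comp] at this

namespace IsProjectiveApproximation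

variable (h : IsProjectiveApproximation J F)
include h

variable [IsIdempotentComplete T] {D : T} (hD : IsOrth J D)
  [HasProjectiveDimensionLT (F.obj D) 2]
include hD

/-- The injectivity in the Universal Coefficient Theorem: a morphism with trivial class is
zero, because a splitting of the extension lifts to a splitting of the triangle. -/
lemma eq_zero_of_isUCTClass_zero {B : T} {f : D ⟶ B}
    (hf : IsUCTClass F f (0 : Ext.{w} (F.obj D) ((F.obj B)⟦(-1 : ℤ)⟧) 1)) : f = 0 := by
  obtain ⟨E, a, b, c, hT, rfl, h0, hS, hx⟩ := hf
  have hS0 : extCls.{w} hS = 0 :=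
    comp_mk₀_injective_of_isIso ((F.commShiftIso (-1 : ℤ)).hom.app B)
      (hx.symm.trans (Ext.zero_comp _ _ _ _ _).symm)
  obtain ⟨s, hs⟩ := exists_section_of_extCls_eq_zero hS hS0
  obtain ⟨s, rfl⟩ := h.exists_lift hD s
  have : IsIso (F.map (s ≫ b)) := by
    rw [F.map_comp, hs]
    infer_instance
  have := h.isIso_of_isIso_map hD hD (s ≫ b)
  have hbc : b ≫ c = 0 := comp_distTriang_mor_zero₂₃ _ hT
  have hc : c = 0 := by
    rw [← cancel_epi (s ≫ b), Category.assoc, hbc, comp_zero, comp_zero]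
  rw [hc, zero_comp]

/-- The surjectivity onto `Ext¹` in the Universal Coefficient Theorem. -/
lemma exists_of_ext {B : T} (x : Ext.{w} (F.obj D) ((F.obj B)⟦(-1 : ℤ)⟧) 1) :
    ∃ f : D ⟶ B, IsUCTClass F f x := by
  obtain ⟨P₂, P₁, φ, π, κ, hc, hP⟩ := h.exists_isCover_isProj hD
  have := h.projective hc.isProj
  obtain ⟨y, rfl⟩ := exists_extCls_comp_eq hc.shortExact (add_zero 1) x
  obtain ⟨y, rfl⟩ := Ext.homEquiv₀.symm.surjective y
  obtain ⟨z, hz⟩ := h.exists_map_eq hP (y ≫ (F.commShiftIso (-1 : ℤ)).inv.app B)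
  let f : D ⟶ B :=
    κ ≫ z⟦(1 : ℤ)⟧' ≫ (shiftFunctorCompIsoId T (-1 : ℤ) 1 (by norm_num)).hom.app B
  obtain ⟨x, hx⟩ := exists_isUCTClass.{w} (F := F) f (by
    rw [F.map_comp, hc.map_eq_zero, zero_comp])
  refine ⟨f, ?_⟩
  have := hx.extCls_comp hc.dist hc.shortExact (𝟙 D) z (by simp [f])
  have hz' : F.map z ≫ (F.commShiftIso (-1 : ℤ)).hom.app B = y := by
    rw [hz, Category.assoc, Iso.inv_hom_id_app]
    exact Category.comp_id y
  rw [hz', CategoryTheory.Functor.map_id, Ext.mk₀_id_comp] at this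
  change IsUCTClass F f ((extCls hc.shortExact).comp (Ext.mk₀ y) _)
  rwa [this]

end IsProjectiveApproximation

end UCT

/-! ### The obstruction to lifting a morphism -/

section Obstruction

variable {T : Type u} [Category.{v} T] [HasZeroObject T] [HasShift T ℤ] [Preadditive T]
  [∀ n : ℤ, (shiftFunctor T n).Additive] [Pretriangulated T] {J : MorphismProperty T}
  {A : Type u'} [Category.{v'} A] [Abelian A] [HasShift A ℤ]
  [∀ n : ℤ, (shiftFunctor A n).Additive]
  {F : T ⥤ A} [F.CommShift ℤ] [F.IsHomological] [HasExt.{w} A]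

lemma mk₀_comp_assoc {X Y Z W : A} (f : X ⟶ Y) {a b c : ℕ} (α : Ext.{w} Y Z a) (β : Ext.{w} Z W b)
    (h : a + b = c) : ((Ext.mk₀ f).comp α (zero_add a)).comp β h =
      (Ext.mk₀ f).comp (α.comp β h) (zero_add c) :=
  Ext.comp_assoc _ _ _ _ _ (by rw [zero_add, h])

/-- `e` is the obstruction in `Ext²(F(X), F(Y)[-1])` to lifting `f : F(X) ⟶ F(Y)` to a morphism
`X ⟶ Y`. For a cover `D ⟶ P ⟶ X` and a morphism `g : P ⟶ Y` that lifts
`F(P) ⟶ F(X) ⟶ F(Y)`, it is the product of the class of `F(D) ⟶ F(P) ⟶ F(X)` with the class of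
`D ⟶ P ⟶ Y` in `Ext¹(F(D), F(Y)[-1])`. -/
def IsLiftObstruction (J : MorphismProperty T) (F : T ⥤ A) [F.CommShift ℤ] [F.IsHomological]
    {X Y : T} (f : F.obj X ⟶ F.obj Y) (e : Ext.{w} (F.obj X) ((F.obj Y)⟦(-1 : ℤ)⟧) 2) : Prop :=
  ∃ (D P : T) (φ : D ⟶ P) (π : P ⟶ X) (κ : X ⟶ D⟦(1 : ℤ)⟧) (hc : IsCover J F φ π κ) (g : P ⟶ Y)
    (x : Ext.{w} (F.obj D) ((F.obj Y)⟦(-1 : ℤ)⟧) 1),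
    F.map g = F.map π ≫ f ∧ IsUCTClass F (φ ≫ g) x ∧
    e = (extCls hc.shortExact).comp x one_add_one_eq_two

namespace IsLiftObstruction

variable (h : IsProjectiveApproximation J F)
include h

lemma exists_of {X Y : T} (f : F.obj X ⟶ F.obj Y) :
    ∃ e : Ext.{w} (F.obj X) ((F.obj Y)⟦(-1 : ℤ)⟧) 2, IsLiftObstruction J F f e := by
  obtain ⟨D, P, φ, π, κ, hc⟩ := h.exists_isCover X
  obtain ⟨g, hg⟩ := h.exists_map_eq hc.isProj (F.map π ≫ f)
  obtain ⟨x, hx⟩ := exists_isUCTClass.{w} (F := F) (φ ≫ g) (by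
    rw [F.map_comp, hg, reassoc_of% hc.map_comp_map, zero_comp])
  exact ⟨_, D, P, φ, π, κ, hc, g, x, hg, hx, rfl⟩

lemma naturality {X Y X' Y' : T} {f : F.obj X ⟶ F.obj Y} {f' : F.obj X' ⟶ F.obj Y'}
    {e : Ext.{w} (F.obj X) ((F.obj Y)⟦(-1 : ℤ)⟧) 2}
    {e' : Ext.{w} (F.obj X') ((F.obj Y')⟦(-1 : ℤ)⟧) 2}
    (he : IsLiftObstruction J F f e) (he' : IsLiftObstruction J F f' e') (u : X ⟶ X') (k : Y ⟶ Y')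
    (comm : f ≫ F.map k = F.map u ≫ f') :
    e.comp (Ext.mk₀ ((F.map k)⟦(-1 : ℤ)⟧')) (add_zero 2) =
      (Ext.mk₀ (F.map u)).comp e' (zero_add 2) := by
  obtain ⟨D, P, φ, π, κ, hc, g, x, hg, hx, rfl⟩ := he
  obtain ⟨D', P', φ', π', κ', hc', g', x', hg', hx', rfl⟩ := he'
  obtain ⟨t, l, h₁, h₂, -⟩ := h.exists_isCover_hom hc hc' u
  have h₃ : g ≫ k = l ≫ g' := h.eq_of_isProj hc.isProj (by
    rw [F.map_comp, hg, Category.assoc, comm, F.map_comp, hg', ← F.map_comp_assoc l, ← h₂,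
      F.map_comp_assoc])
  have h₄ := hx.naturality hx' t k (by rw [Category.assoc, h₃, reassoc_of% h₁])
  have h₅ := extCls_naturality.{w} hc.shortExact hc'.shortExact (a := F.map t) (b := F.map l)
    (c := F.map u) (by rw [← F.map_comp, ← F.map_comp, h₁])
    (by rw [← F.map_comp, ← F.map_comp, h₂])
  rw [Ext.comp_assoc_of_third_deg_zero, h₄, ← Ext.comp_assoc_of_second_deg_zero, h₅,
    mk₀_comp_assoc]

lemma eq {X Y : T} {f : F.obj X ⟶ F.obj Y} {e e' : Ext.{w} (F.obj X) ((F.obj Y)⟦(-1 : ℤ)⟧) 2}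
    (he : IsLiftObstruction J F f e) (he' : IsLiftObstruction J F f e') : e = e' := by
  simpa using naturality h he he' (𝟙 X) (𝟙 Y) (by simp)

lemma eq_zero_of_map {X Y : T} (u : X ⟶ Y) {e : Ext.{w} (F.obj X) ((F.obj Y)⟦(-1 : ℤ)⟧) 2}
    (he : IsLiftObstruction J F (F.map u) e) : e = 0 := by
  obtain ⟨D, P, φ, π, κ, hc⟩ := h.exists_isCover X
  refine eq h he ⟨D, P, φ, π, κ, hc, π ≫ u, 0, F.map_comp _ _, ?_, (Ext.comp_zero _ _ _ _ _).symm⟩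
  rw [reassoc_of% hc.comp_eq_zero, zero_comp]
  exact isUCTClass_zero _ _

variable [IsIdempotentComplete T]

/-- A morphism with vanishing obstruction lifts: the class of `D ⟶ P ⟶ Y` itself vanishes because
`F(P)` is projective, and so does `D ⟶ P ⟶ Y` by the Universal Coefficient Theorem. -/
lemma exists_lift {X Y : T} (hX : IsOrth J X) [HasProjectiveDimensionLT (F.obj X) 3]
    {f : F.obj X ⟶ F.obj Y}
    (he : IsLiftObstruction J F f (0 : Ext.{w} (F.obj X) ((F.obj Y)⟦(-1 : ℤ)⟧) 2)) :
    ∃ u : X ⟶ Y, F.map u = f := by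
  obtain ⟨D, P, φ, π, κ, hc, g, x, hg, hx, he⟩ := he
  have := h.projective hc.isProj
  have := hc.hasProjectiveDimensionLT h 1
  obtain rfl : x = 0 := eq_zero_of_extCls_comp_eq_zero _ _ he.symm
  obtain ⟨u, rfl⟩ := hc.exists_desc g (h.eq_zero_of_isUCTClass_zero (hc.isOrth h hX) hx)
  have := hc.epi
  exact ⟨u, by rw [← cancel_epi (F.map π), ← F.map_comp, hg]⟩

/-- The lifting obstruction is a derivation with respect to composition. -/
lemma comp {X Y Z : T} (hX : IsOrth J X) [HasProjectiveDimensionLT (F.obj X) 3]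
    {f : F.obj X ⟶ F.obj Y} {f' : F.obj Y ⟶ F.obj Z}
    {e : Ext.{w} (F.obj X) ((F.obj Y)⟦(-1 : ℤ)⟧) 2}
    {e' : Ext.{w} (F.obj Y) ((F.obj Z)⟦(-1 : ℤ)⟧) 2}
    (he : IsLiftObstruction J F f e) (he' : IsLiftObstruction J F f' e') :
    IsLiftObstruction J F (f ≫ f') (e.comp (Ext.mk₀ (f'⟦(-1 : ℤ)⟧')) (add_zero 2) +
      (Ext.mk₀ f).comp e' (zero_add 2)) := by
  obtain ⟨D, P, φ, π, κ, hc, g, x, hg, hx, rfl⟩ := he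
  obtain ⟨D', P', φ', π', κ', hc', g', x', hg', hx', rfl⟩ := he'
  have := h.projective hc.isProj
  have := hc'.epi
  have := hc.hasProjectiveDimensionLT h 1
  obtain ⟨l, hl⟩ := h.exists_map_eq hc.isProj (Projective.factorThru (F.map π ≫ f) (F.map π'))
  have hl' : F.map l ≫ F.map π' = F.map π ≫ f := by rw [hl, Projective.factorThru_comp]
  have hlg : l ≫ π' = g := h.eq_of_isProj hc.isProj (by rw [F.map_comp, hl', hg])
  -- By the Universal Coefficient Theorem, the induced morphism `F(D) ⟶ F(D')` lifts. The lifting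
  -- commutes with the morphisms to `P'` only up to a morphism `ρ` that `F` annihilates.
  have hm := hc'.shortExact.mono_f
  obtain ⟨t, ht⟩ := h.exists_lift (hc.isOrth h hX) (hc'.shortExact.exact.lift (F.map φ ≫ F.map l)
    (by
      change (F.map φ ≫ F.map l) ≫ F.map π' = 0
      rw [Category.assoc, hl', reassoc_of% hc.map_comp_map, zero_comp]))
  have ht' : F.map t ≫ F.map φ' = F.map φ ≫ F.map l := by
    rw [ht]
    exact hc'.shortExact.exact.lift_f _ _
  obtain ⟨r, hr⟩ := exists_isUCTClass.{w} (F := F) (φ ≫ l - t ≫ φ') (by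
    rw [F.map_sub, F.map_comp, F.map_comp, ht', sub_self])
  have h₁ : x = r.comp (Ext.mk₀ ((F.map π')⟦(-1 : ℤ)⟧')) (add_zero 1) := by
    refine hx.eq ?_
    convert hr.postcomp π' using 1
    rw [Preadditive.sub_comp, Category.assoc, Category.assoc, hc'.comp_eq_zero, comp_zero,
      sub_zero, hlg]
  have h₂ : IsUCTClass F (φ ≫ l ≫ g')
      (r.comp (Ext.mk₀ ((F.map g')⟦(-1 : ℤ)⟧')) (add_zero 1) +
        (Ext.mk₀ (F.map t)).comp x' (zero_add 1)) := by
    convert (hr.postcomp g').add (hx'.precomp t) using 1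
    rw [Preadditive.sub_comp, Category.assoc, Category.assoc, sub_add_cancel]
  have h₃ := extCls_naturality.{w} hc.shortExact hc'.shortExact (a := F.map t) (b := F.map l)
    (c := f) ht' hl'
  refine ⟨D, P, φ, π, κ, hc, l ≫ g', _, ?_, h₂, ?_⟩
  · rw [F.map_comp, hg', reassoc_of% hl']
  · rw [h₁, hg', Functor.map_comp, ← Ext.mk₀_comp_mk₀, Ext.comp_add,
      ← Ext.comp_assoc_of_second_deg_zero _ (Ext.mk₀ (F.map t)), h₃, mk₀_comp_assoc,
      Ext.comp_assoc_of_third_deg_zero, Ext.comp_assoc_of_second_deg_zero]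

end IsLiftObstruction

/-! ### Relative obstruction classes of liftings -/

lemma IsCover.shortExact_of_iso {D P X : T} {φ : D ⟶ P} {π : P ⟶ X} {κ : X ⟶ D⟦(1 : ℤ)⟧}
    (hc : IsCover J F φ π κ) {M : A} (i : F.obj X ≅ M) {p : F.obj P ⟶ M}
    (hp : F.map π ≫ i.hom = p) (zero : F.map φ ≫ p = 0) :
    (ShortComplex.mk (F.map φ) p zero).ShortExact :=
  ShortComplex.shortExact_of_iso (ShortComplex.isoMk
    (S₁ := ShortComplex.mk (F.map φ) (F.map π) hc.map_comp_map)
    (S₂ := ShortComplex.mk (F.map φ) p zero) (Iso.refl _) (Iso.refl _) i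
    ((Category.id_comp _).trans (Category.comp_id _).symm)
    ((Category.id_comp _).trans hp.symm)) hc.shortExact

lemma distinguished_iso_comp {D P X D' : T} {φ : D ⟶ P} {π : P ⟶ X} {κ : X ⟶ D⟦(1 : ℤ)⟧}
    (hT : Triangle.mk φ π κ ∈ distTriang T) (t : D' ≅ D) :
    Triangle.mk (t.hom ≫ φ) π (κ ≫ t.inv⟦(1 : ℤ)⟧') ∈ distTriang T :=
  have h₃ : (κ ≫ t.inv⟦(1 : ℤ)⟧') ≫ t.hom⟦(1 : ℤ)⟧' = 𝟙 X ≫ κ := by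
    rw [Category.assoc, ← Functor.map_comp, Iso.inv_hom_id, CategoryTheory.Functor.map_id,
      Category.comp_id, Category.id_comp]
  isomorphic_distinguished _ hT _ (Triangle.isoMk
    (Triangle.mk (t.hom ≫ φ) π (κ ≫ t.inv⟦(1 : ℤ)⟧')) (Triangle.mk φ π κ) t (Iso.refl _)
    (Iso.refl _) (Category.comp_id _) ((Category.comp_id π).trans (Category.id_comp π).symm) h₃)

variable (h : IsProjectiveApproximation J F)
include h

/-- The relative obstruction class of two liftings of `M` is the obstruction to lifting the
identity morphism of `M` to a morphism between them. -/
lemma IsRelObstructionClass.comp_eq {M : A} {L₂ L₁ : Lifting J F M}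
    {e : Ext.{w} M (M⟦(-1 : ℤ)⟧) 2} (he : IsRelObstructionClass L₂ L₁ e)
    {o : Ext.{w} (F.obj L₂.obj) ((F.obj L₁.obj)⟦(-1 : ℤ)⟧) 2}
    (ho : IsLiftObstruction J F (L₂.iso.hom ≫ L₁.iso.inv) o) :
    o.comp (Ext.mk₀ (L₁.iso.hom⟦(-1 : ℤ)⟧')) (add_zero 2) =
      (Ext.mk₀ L₂.iso.hom).comp e (zero_add 2) := by
  obtain ⟨P, D, p, φ₁, φ₂, π₁, κ₁, π₂, κ₂, hP, hT₁, hT₂, hp₁, hp₂, hφ, h0, hS, x, hx, rfl⟩ := he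
  have hφπ : φ₁ ≫ π₁ = 0 := comp_distTriang_mor_zero₁₂ _ hT₁
  have : Epi p := hS.epi_g
  have hc : IsCover J F φ₂ π₂ κ₂ := ⟨hT₂, hP, by
    rw [← Iso.eq_comp_inv] at hp₂
    rw [hp₂]
    infer_instance⟩
  have ho' : IsLiftObstruction J F (L₂.iso.hom ≫ L₁.iso.inv)
      ((extCls hc.shortExact).comp (x.comp (Ext.mk₀ ((F.map π₁)⟦(-1 : ℤ)⟧')) (add_zero 1))
        one_add_one_eq_two) := by
    refine ⟨D, P, φ₂, π₂, κ₂, hc, π₁, _, ?_, ?_, rfl⟩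
    · rw [reassoc_of% hp₂, Iso.eq_comp_inv, hp₁]
    · convert hx.postcomp π₁ using 1
      rw [Preadditive.sub_comp, hφπ, sub_zero]
  have h₁ := extCls_naturality.{w} hc.shortExact hS (a := 𝟙 _) (b := 𝟙 _) (c := L₂.iso.hom)
    (by rw [Category.id_comp, Category.comp_id, hφ]) (by rw [Category.id_comp, hp₂])
  rw [Ext.comp_mk₀_id] at h₁
  have hp : p⟦(-1 : ℤ)⟧' = (F.map π₁)⟦(-1 : ℤ)⟧' ≫ L₁.iso.hom⟦(-1 : ℤ)⟧' := by
    rw [← hp₁, Functor.map_comp]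
  rw [IsLiftObstruction.eq h ho ho', h₁, hp, ← Ext.mk₀_comp_mk₀, mk₀_comp_assoc, mk₀_comp_assoc,
    Ext.comp_assoc_of_third_deg_zero, Ext.comp_assoc_of_third_deg_zero]
  rfl

variable [IsIdempotentComplete T]

lemma exists_isRelObstructionClass {M : A} [HasProjectiveDimensionLT M 3]
    (L₂ L₁ : Lifting J F M) :
    ∃ e : Ext.{w} M (M⟦(-1 : ℤ)⟧) 2, IsRelObstructionClass L₂ L₁ e := by
  obtain ⟨P, hP, p, _⟩ := h.exists_epi M
  obtain ⟨π₁, hπ₁⟩ := h.exists_map_eq hP (p ≫ L₁.iso.inv)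
  obtain ⟨π₂, hπ₂⟩ := h.exists_map_eq hP (p ≫ L₂.iso.inv)
  have hp₁ : F.map π₁ ≫ L₁.iso.hom = p := by simp [hπ₁]
  have hp₂ : F.map π₂ ≫ L₂.iso.hom = p := by simp [hπ₂]
  obtain ⟨D, φ₁, κ₁, hT₁⟩ := distinguished_cocone_triangle₁ π₁
  obtain ⟨D₂, φ₂, κ₂, hT₂⟩ := distinguished_cocone_triangle₁ π₂
  have hc₁ : IsCover J F φ₁ π₁ κ₁ := ⟨hT₁, hP, by rw [hπ₁]; infer_instance⟩
  have hc₂ : IsCover J F φ₂ π₂ κ₂ := ⟨hT₂, hP, by rw [hπ₂]; infer_instance⟩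
  have h₁ : F.map φ₁ ≫ p = 0 := by rw [← hp₁, reassoc_of% hc₁.map_comp_map, zero_comp]
  have h₂ : F.map φ₂ ≫ p = 0 := by rw [← hp₂, reassoc_of% hc₂.map_comp_map, zero_comp]
  have hS₁ := hc₁.shortExact_of_iso L₁.iso hp₁ h₁
  have hS₂ := hc₂.shortExact_of_iso L₂.iso hp₂ h₂
  have : Mono (F.map φ₁) := hS₁.mono_f
  have : Mono (F.map φ₂) := hS₂.mono_f
  have hD : IsOrth J D := hc₁.isOrth h L₁.orth
  have hpd : HasProjectiveDimensionLT (F.obj L₁.obj) 3 :=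
    hasProjectiveDimensionLT_of_iso L₁.iso.symm 3
  have hpd' : HasProjectiveDimensionLT (F.obj D) 2 := hc₁.hasProjectiveDimensionLT h 1
  -- Both `F(D)` and `F(D₂)` are kernels of `p`; the isomorphism between them lifts.
  obtain ⟨a, ha⟩ : ∃ a, a ≫ F.map φ₂ = F.map φ₁ :=
    ⟨hS₂.exact.lift (F.map φ₁) h₁, hS₂.exact.lift_f _ _⟩
  obtain ⟨b, hb⟩ : ∃ b, b ≫ F.map φ₁ = F.map φ₂ :=
    ⟨hS₁.exact.lift (F.map φ₂) h₂, hS₁.exact.lift_f _ _⟩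
  obtain ⟨t, rfl⟩ := h.exists_lift hD a
  have : IsIso (F.map t) := ⟨b, by
    rw [← cancel_mono (F.map φ₁), Category.assoc, hb, ha, Category.id_comp], by
    rw [← cancel_mono (F.map φ₂), Category.assoc, ha, hb, Category.id_comp]⟩
  have ht : IsIso t := h.isIso_of_isIso_map hD (hc₂.isOrth h L₂.orth) t
  have hT := distinguished_iso_comp hT₂ (asIso t)
  have hφ : F.map φ₁ = F.map (t ≫ φ₂) := by rw [F.map_comp, ha]
  obtain ⟨x, hx⟩ := exists_isUCTClass.{w} (F := F) (t ≫ φ₂ - φ₁) (by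
    rw [F.map_sub, hφ, sub_self])
  exact ⟨_, P, D, p, φ₁, t ≫ φ₂, π₁, κ₁, π₂, _, hP, hT₁, hT, hp₁, hp₂, hφ, h₁, hS₁, x, hx, rfl⟩

end Obstruction

/-! ### Even decompositions -/

section Parity

variable {A : Type u'} [Category.{v'} A] [Abelian A] [HasShift A ℤ]

namespace EvenDecomposition

/-- The decomposition with the roles of the even and the odd objects exchanged. -/
def swap (dec : EvenDecomposition A) : EvenDecomposition A where
  pos := dec.neg
  neg := dec.pos
  pos_iso := dec.neg_iso
  neg_iso := dec.pos_iso
  pos_neg := dec.neg_pos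
  neg_pos := dec.pos_neg
  decomp X :=
    have ⟨X₀, X₁, h₀, h₁, ⟨e⟩⟩ := dec.decomp X
    ⟨X₁, X₀, h₁, h₀, ⟨e ≪≫ biprod.braiding X₀ X₁⟩⟩
  shift_pos := dec.shift_neg
  shift_neg := dec.shift_pos

variable (dec : EvenDecomposition A)

lemma pos_of_mono {X Y : A} (f : X ⟶ Y) [Mono f] (hY : dec.pos Y) : dec.pos X := by
  have := dec.pos_iso
  obtain ⟨X₀, X₁, h₀, h₁, ⟨e⟩⟩ := dec.decomp X
  have hi : (biprod.inr : X₁ ⟶ X₀ ⊞ X₁) = 0 := by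
    rw [← cancel_mono (e.inv ≫ f), zero_comp]
    exact dec.neg_pos h₁ hY _
  refine dec.pos.prop_of_iso ?_ h₀
  refine ⟨biprod.inl ≫ e.inv, e.hom ≫ biprod.fst, by simp, ?_⟩
  have h : biprod.fst ≫ biprod.inl = 𝟙 (X₀ ⊞ X₁) := by
    rw [← biprod.total, hi, comp_zero, add_zero]
  rw [Category.assoc, reassoc_of% h, Iso.hom_inv_id]

lemma exists_pos_projective [EnoughProjectives A] {M : A} (hM : dec.pos M) :
    ∃ (Q : A) (_ : Projective Q) (_ : dec.pos Q) (p : Q ⟶ M), Epi p := by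
  obtain ⟨Q₀, Q₁, h₀, h₁, ⟨e⟩⟩ := dec.decomp (Projective.over M)
  have hQ : Projective Q₀ :=
    (Retract.mk (biprod.inl ≫ e.inv) (e.hom ≫ biprod.fst) (by simp)).projective
  have hp : biprod.inr ≫ e.inv ≫ Projective.π M = 0 := dec.neg_pos h₁ hM _
  refine ⟨Q₀, hQ, h₀, biprod.inl ≫ e.inv ≫ Projective.π M, ?_⟩
  have h : biprod.fst ≫ biprod.inl ≫ e.inv ≫ Projective.π M = e.inv ≫ Projective.π M := by
    ext
    · simp
    · simp [hp]
  have : Epi (e.inv ≫ Projective.π M) := epi_comp _ _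
  exact epi_of_epi_fac h

/-- There are no extensions between even and odd objects: kernels of covers of even objects by even
projective objects are even, so dimension shifting applies. -/
lemma ext_eq_zero [EnoughProjectives A] [HasExt.{w} A] (n : ℕ) {M N : A} (hM : dec.pos M)
    (hN : dec.neg N) (e : Ext.{w} M N n) : e = 0 := by
  induction n generalizing M with
  | zero =>
    obtain ⟨f, rfl⟩ := Ext.homEquiv₀.symm.surjective e
    rw [dec.pos_neg hM hN f]
    exact Ext.mk₀_zero _ _
  | succ n hn =>
    obtain ⟨Q, _, hQ, p, _⟩ := dec.exists_pos_projective hM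
    have hS : (ShortComplex.mk (kernel.ι p) p (kernel.condition p)).ShortExact :=
      { exact := ShortComplex.exact_of_f_is_kernel _ (kernelIsKernel p) }
    have : HasProjectiveDimensionLT Q (n + 1) := hasProjectiveDimensionLT_of_ge Q 1 _ (by omega)
    obtain ⟨x, rfl⟩ := exists_extCls_comp_eq hS (add_comm 1 n) e
    rw [hn (dec.pos_of_mono (kernel.ι p) hQ) x, Ext.comp_zero]

end EvenDecomposition

end Parity

/-! ### Liftings -/

section Liftings

variable {T : Type u} [Category.{v} T] [HasZeroObject T] [HasShift T ℤ] [Preadditive T]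
  [∀ n : ℤ, (shiftFunctor T n).Additive] [Pretriangulated T] {J : MorphismProperty T}
  {A : Type u'} [Category.{v'} A] [Abelian A] [HasShift A ℤ]
  [∀ n : ℤ, (shiftFunctor A n).Additive]
  {F : T ⥤ A} [F.CommShift ℤ] [F.IsHomological]

lemma map_mor₃_eq_zero_of_mono {X Y Z : T} {f : X ⟶ Y} {g : Y ⟶ Z} {k : Z ⟶ X⟦(1 : ℤ)⟧}
    (hT : Triangle.mk f g k ∈ distTriang T) [Mono (F.map f)] : F.map k = 0 := by
  have hk : k ≫ f⟦(1 : ℤ)⟧' = 0 := comp_distTriang_mor_zero₃₁ _ hT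
  have hF := (F.commShiftIso (1 : ℤ)).hom.naturality f
  dsimp at hF
  have : Mono (F.map (f⟦(1 : ℤ)⟧')) := by
    have : Mono (F.map (f⟦(1 : ℤ)⟧') ≫ (F.commShiftIso (1 : ℤ)).hom.app Y) := by
      rw [hF]
      exact mono_comp _ _
    exact mono_of_mono _ ((F.commShiftIso (1 : ℤ)).hom.app Y)
  rw [← cancel_mono (F.map (f⟦(1 : ℤ)⟧')), ← F.map_comp, hk, F.map_zero, zero_comp]

namespace IsProjectiveApproximation

variable (h : IsProjectiveApproximation J F)
include h

lemma enoughProjectives : EnoughProjectives A where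
  presentation M := by
    obtain ⟨P, hP, p, _⟩ := h.exists_epi M
    have := h.projective hP
    exact ⟨⟨F.obj P, p⟩⟩

/-- The cone of a lifting of a presentation of `M` is a lifting of `M`. -/
lemma exists_lifting_of_shortExact {D P : T} (hD : IsOrth J D) (hP : IsProj J P) (φ : D ⟶ P)
    {M : A} {p : F.obj P ⟶ M} {zero : F.map φ ≫ p = 0}
    (hS : (ShortComplex.mk (F.map φ) p zero).ShortExact) :
    ∃ (L : Lifting J F M) (π : P ⟶ L.obj) (κ : L.obj ⟶ D⟦(1 : ℤ)⟧),
      Triangle.mk φ π κ ∈ distTriang T ∧ F.map π ≫ L.iso.hom = p := by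
  have := h.isTriangulated_isOrth
  have := h.isClosedUnderIsomorphisms_isOrth
  obtain ⟨X, π, κ, hT⟩ := distinguished_cocone_triangle φ
  have hX : IsOrth J X := (IsOrth J).ext_of_isTriangulatedClosed₃ _ hT hD hP.isOrth
  have : Mono (F.map φ) := hS.mono_f
  have : Epi p := hS.epi_g
  have zero' : F.map φ ≫ F.map π = 0 := by
    have : φ ≫ π = 0 := comp_distTriang_mor_zero₁₂ _ hT
    rw [← F.map_comp, this, F.map_zero]
  have hS' := shortExact_of_map_eq_zero hT (map_mor₃_eq_zero_of_mono (F := F) hT) zero'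
  have : Epi (F.map π) := hS'.epi_g
  obtain ⟨a, ha⟩ : ∃ a, F.map π ≫ a = p :=
    ⟨hS'.exact.desc p zero, hS'.exact.g_desc _ _⟩
  obtain ⟨b, hb⟩ : ∃ b, p ≫ b = F.map π :=
    ⟨hS.exact.desc (F.map π) zero', hS.exact.g_desc _ _⟩
  refine ⟨⟨X, hX, ⟨a, b, ?_, ?_⟩⟩, π, κ, hT, ha⟩
  · rw [← cancel_epi (F.map π), reassoc_of% ha, hb, Category.comp_id]
  · rw [← cancel_epi p, reassoc_of% hb, ha, Category.comp_id]

/-- Objects of projective dimension at most `2` have liftings: the Universal Coefficient Theorem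
lifts the inclusion of the kernel of a projective cover. -/
lemma nonempty_lifting [IsIdempotentComplete T] {n : ℕ} (hn : n ≤ 2) (M : A)
    [HasProjectiveDimensionLT M (n + 1)] : Nonempty (Lifting J F M) := by
  induction n generalizing M with
  | zero =>
    have : Projective M := projective_iff_hasProjectiveDimensionLT_one.2 ‹_›
    obtain ⟨P, hP, ⟨e⟩⟩ := h.exists_isProj_iso M
    exact ⟨⟨P, hP.isOrth, e⟩⟩
  | succ n ih =>
    obtain ⟨P, hP, p, _⟩ := h.exists_epi M
    have hS : (ShortComplex.mk (kernel.ι p) p (kernel.condition p)).ShortExact :=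
      { exact := ShortComplex.exact_of_f_is_kernel _ (kernelIsKernel p) }
    have hK : HasProjectiveDimensionLT (kernel p) (n + 1) :=
      (hS.hasProjectiveDimensionLT_X₃_iff n (h.projective hP)).1 ‹_›
    obtain ⟨L⟩ := ih (by omega) (kernel p)
    have hK₂ : HasProjectiveDimensionLT (kernel p) 2 :=
      hasProjectiveDimensionLT_of_ge _ (n + 1) 2 (by omega)
    have := hasProjectiveDimensionLT_of_iso L.iso.symm 2
    obtain ⟨φ, hφ⟩ := h.exists_lift L.orth (L.iso.hom ≫ kernel.ι p)
    have zero : F.map φ ≫ p = 0 := by rw [hφ, Category.assoc, kernel.condition, comp_zero]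
    have hS' : (ShortComplex.mk (F.map φ) p zero).ShortExact :=
      ShortComplex.shortExact_of_iso (ShortComplex.isoMk
        (S₁ := ShortComplex.mk (kernel.ι p) p (kernel.condition p))
        (S₂ := ShortComplex.mk (F.map φ) p zero) L.iso.symm (Iso.refl _) (Iso.refl _)
        ((Iso.inv_comp_eq _).2 (hφ.trans (congrArg (L.iso.hom ≫ ·) (Category.comp_id _).symm)))
        ((Category.id_comp _).trans (Category.comp_id _).symm)) hS
    obtain ⟨L', -⟩ := h.exists_lifting_of_shortExact L.orth hP φ hS'
    exact ⟨L'⟩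

end IsProjectiveApproximation

variable (dec : EvenDecomposition A)

/-- `X` is a direct sum of an object with even image and an object with odd image. -/
def IsParitySum (J : MorphismProperty T) (F : T ⥤ A) (dec : EvenDecomposition A) (X : T) : Prop :=
  ∃ (X₀ X₁ : T) (_ : X ≅ X₀ ⊞ X₁), IsOrth J X₀ ∧ IsOrth J X₁ ∧
    dec.pos (F.obj X₀) ∧ dec.neg (F.obj X₁)

variable {dec}

lemma IsCanonical.isParitySum {M : A} {L : Lifting J F M} (hL : IsCanonical dec L) :
    IsParitySum J F dec L.obj := by
  obtain ⟨M₀, M₁, h₀, h₁, b, L₀, L₁, s, -, -⟩ := hL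
  have := dec.pos_iso
  have := dec.neg_iso
  exact ⟨L₀.obj, L₁.obj, s, L₀.orth, L₁.orth, dec.pos.prop_of_iso L₀.iso.symm h₀,
    dec.neg.prop_of_iso L₁.iso.symm h₁⟩

lemma IsCanonical.of_iso {M M' : A} {L : Lifting J F M} (hL : IsCanonical dec L) (i : M ≅ M') :
    IsCanonical dec (⟨L.obj, L.orth, L.iso ≪≫ i⟩ : Lifting J F M') := by
  obtain ⟨M₀, M₁, h₀, h₁, b, L₀, L₁, s, hs₀, hs₁⟩ := hL
  exact ⟨M₀, M₁, h₀, h₁, i.symm ≪≫ b, L₀, L₁, s, by simpa using hs₀, by simpa using hs₁⟩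

variable (h : IsProjectiveApproximation J F) [IsIdempotentComplete T]
  (hdim : ∀ M : A, HasProjectiveDimensionLT M 3)
include h hdim

lemma exists_isCanonical (dec : EvenDecomposition A) (M : A) :
    ∃ L : Lifting J F M, IsCanonical dec L := by
  have := h.isTriangulated_isOrth
  have := h.isClosedUnderIsomorphisms_isOrth
  obtain ⟨M₀, M₁, h₀, h₁, ⟨b⟩⟩ := dec.decomp M
  obtain ⟨L₀⟩ := h.nonempty_lifting le_rfl M₀
  obtain ⟨L₁⟩ := h.nonempty_lifting le_rfl M₁
  have hL : IsOrth J (L₀.obj ⊞ L₁.obj) :=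
    (IsOrth J).ext_of_isTriangulatedClosed₂ _ (binaryBiproductTriangle_distinguished _ _)
      L₀.orth L₁.orth
  have : PreservesBinaryBiproducts F := preservesBinaryBiproducts_of_preservesBiproducts F
  obtain ⟨j, hj₀, hj₁⟩ : ∃ j : F.obj (L₀.obj ⊞ L₁.obj) ≅ F.obj L₀.obj ⊞ F.obj L₁.obj,
      j.hom ≫ biprod.fst = F.map biprod.fst ∧ j.hom ≫ biprod.snd = F.map biprod.snd :=
    ⟨F.mapBiprod _ _, by rw [F.mapBiprod_hom, biprod.lift_fst],
      by rw [F.mapBiprod_hom, biprod.lift_snd]⟩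
  obtain ⟨i, hi₀, hi₁⟩ : ∃ i : F.obj (L₀.obj ⊞ L₁.obj) ≅ M,
      i.hom ≫ b.hom ≫ biprod.fst = F.map biprod.fst ≫ L₀.iso.hom ∧
      i.hom ≫ b.hom ≫ biprod.snd = F.map biprod.snd ≫ L₁.iso.hom :=
    ⟨j ≪≫ biprod.mapIso L₀.iso L₁.iso ≪≫ b.symm, by simp [reassoc_of% hj₀],
      by simp [reassoc_of% hj₁]⟩
  exact ⟨⟨_, hL, i⟩, M₀, M₁, h₀, h₁, b, L₀, L₁, Iso.refl _,
    hi₀.trans (congrArg (fun k => F.map k ≫ L₀.iso.hom) (Category.id_comp biprod.fst).symm),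
    hi₁.trans (congrArg (fun k => F.map k ≫ L₁.iso.hom) (Category.id_comp biprod.snd).symm)⟩

variable [HasExt.{w} A]

lemma exists_lift_of_pos {X Y : T} (hX : IsOrth J X) (hX₀ : dec.pos (F.obj X))
    (hY₀ : dec.pos (F.obj Y)) (f : F.obj X ⟶ F.obj Y) : ∃ u : X ⟶ Y, F.map u = f := by
  have := h.enoughProjectives
  obtain ⟨e, he⟩ := IsLiftObstruction.exists_of.{w} h f
  rw [dec.ext_eq_zero 2 hX₀ ((dec.shift_pos _).1 hY₀) e] at he
  exact he.exists_lift h hX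

/-- Between direct sums of objects with even and odd image all morphisms lift: the obstructions
belong to vanishing groups. -/
lemma IsParitySum.exists_lift {X Y : T} (hX : IsParitySum J F dec X) (hY : IsParitySum J F dec Y)
    (f : F.obj X ⟶ F.obj Y) : ∃ u : X ⟶ Y, F.map u = f := by
  obtain ⟨X₀, X₁, s, hX₀, hX₁, hX₀', hX₁'⟩ := hX
  obtain ⟨Y₀, Y₁, t, hY₀, hY₁, hY₀', hY₁'⟩ := hY
  obtain ⟨u₀, hu₀⟩ := exists_lift_of_pos.{w} h hdim hX₀ hX₀' hY₀'
    (F.map (biprod.inl ≫ s.inv) ≫ f ≫ F.map (t.hom ≫ biprod.fst))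
  obtain ⟨u₁, hu₁⟩ := exists_lift_of_pos.{w} (dec := dec.swap) h hdim hX₁ hX₁' hY₁'
    (F.map (biprod.inr ≫ s.inv) ≫ f ≫ F.map (t.hom ≫ biprod.snd))
  have h₀₁ : F.map (biprod.inl ≫ s.inv) ≫ f ≫ F.map (t.hom ≫ biprod.snd) = 0 :=
    dec.pos_neg hX₀' hY₁' _
  have h₁₀ : F.map (biprod.inr ≫ s.inv) ≫ f ≫ F.map (t.hom ≫ biprod.fst) = 0 :=
    dec.neg_pos hX₁' hY₀' _
  refine ⟨s.hom ≫ (biprod.fst ≫ u₀ ≫ biprod.inl + biprod.snd ≫ u₁ ≫ biprod.inr) ≫ t.inv, ?_⟩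
  have hX : 𝟙 (F.obj X) = F.map (s.hom ≫ biprod.fst) ≫ F.map (biprod.inl ≫ s.inv) +
      F.map (s.hom ≫ biprod.snd) ≫ F.map (biprod.inr ≫ s.inv) := by
    rw [← F.map_comp, ← F.map_comp, ← F.map_add, ← CategoryTheory.Functor.map_id]
    congr 1
    rw [← cancel_epi s.inv, ← cancel_mono s.hom]
    simp [Preadditive.add_comp, biprod.total]
  have hY : 𝟙 (F.obj Y) = F.map (t.hom ≫ biprod.fst) ≫ F.map (biprod.inl ≫ t.inv) +
      F.map (t.hom ≫ biprod.snd) ≫ F.map (biprod.inr ≫ t.inv) := by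
    rw [← F.map_comp, ← F.map_comp, ← F.map_add, ← CategoryTheory.Functor.map_id]
    congr 1
    rw [← cancel_epi t.inv, ← cancel_mono t.hom]
    simp [Preadditive.add_comp, biprod.total]
  calc _ = F.map (s.hom ≫ biprod.fst) ≫ F.map u₀ ≫ F.map (biprod.inl ≫ t.inv) +
        F.map (s.hom ≫ biprod.snd) ≫ F.map u₁ ≫ F.map (biprod.inr ≫ t.inv) := by
        simp only [← F.map_comp, ← F.map_add]
        simp
    _ = 𝟙 (F.obj X) ≫ f ≫ 𝟙 (F.obj Y) := by
        rw [hX, hY, hu₀, hu₁]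
        simp only [Preadditive.add_comp, Preadditive.comp_add, Category.assoc,
          reassoc_of% h₀₁, reassoc_of% h₁₀, zero_comp, comp_zero, add_zero, zero_add]
    _ = f := by rw [Category.comp_id, Category.id_comp]

end Liftings

/-! ### Obstruction classes of objects -/

section Classification

variable {T : Type u} [Category.{v} T] [HasZeroObject T] [HasShift T ℤ] [Preadditive T]
  [∀ n : ℤ, (shiftFunctor T n).Additive] [Pretriangulated T] [IsIdempotentComplete T]
  {J : MorphismProperty T}
  {A : Type u'} [Category.{v'} A] [Abelian A] [HasShift A ℤ]
  [∀ n : ℤ, (shiftFunctor A n).Additive] [HasExt.{w} A]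
  {F : T ⥤ A} [F.CommShift ℤ] [F.IsHomological]
  (h : IsProjectiveApproximation J F) (hdim : ∀ M : A, HasProjectiveDimensionLT M 3)
  {dec : EvenDecomposition A}
include h hdim

lemma exists_isObstructionClass {X : T} (hX : IsOrth J X) :
    ∃ d : Ext.{w} (F.obj X) ((F.obj X)⟦(-1 : ℤ)⟧) 2, IsObstructionClass J F dec X d := by
  obtain ⟨L, hL⟩ := exists_isCanonical h hdim dec (F.obj X)
  obtain ⟨d, hd⟩ := exists_isRelObstructionClass.{w} h ⟨X, hX, Iso.refl _⟩ L
  exact ⟨d, hX, L, hL, hd⟩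

/-- The obstruction to lifting `q : F(X) ⟶ F(Y)` is the failure of `q` to be compatible with the
obstruction classes of `X` and `Y`. This follows from the derivation property, because all
morphisms between the canonical liftings lift. -/
lemma IsObstructionClass.liftObstruction_add {X Y : T}
    {dX : Ext.{w} (F.obj X) ((F.obj X)⟦(-1 : ℤ)⟧) 2}
    {dY : Ext.{w} (F.obj Y) ((F.obj Y)⟦(-1 : ℤ)⟧) 2}
    (hX : IsObstructionClass J F dec X dX) (hY : IsObstructionClass J F dec Y dY)
    {q : F.obj X ⟶ F.obj Y} {o : Ext.{w} (F.obj X) ((F.obj Y)⟦(-1 : ℤ)⟧) 2}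
    (ho : IsLiftObstruction J F q o) :
    o + (Ext.mk₀ q).comp dY (zero_add 2) =
      dX.comp (Ext.mk₀ (q⟦(-1 : ℤ)⟧')) (add_zero 2) := by
  obtain ⟨hX', L, hL, hdX⟩ := hX
  obtain ⟨hY', M, hM, hdY⟩ := hY
  obtain ⟨oX, hoX⟩ := IsLiftObstruction.exists_of.{w} h (Y := L.obj) L.iso.inv
  obtain ⟨oY, hoY⟩ := IsLiftObstruction.exists_of.{w} h (Y := M.obj) M.iso.inv
  have hX₁ : oX.comp (Ext.mk₀ (L.iso.hom⟦(-1 : ℤ)⟧')) (add_zero 2) = dX :=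
    (hdX.comp_eq h (by simpa using hoX)).trans (Ext.mk₀_id_comp dX)
  have hY₁ : oY.comp (Ext.mk₀ (M.iso.hom⟦(-1 : ℤ)⟧')) (add_zero 2) = dY :=
    (hdY.comp_eq h (by simpa using hoY)).trans (Ext.mk₀_id_comp dY)
  obtain ⟨u, hu⟩ := hL.isParitySum.exists_lift.{w} h hdim hM.isParitySum
    (L.iso.hom ≫ q ≫ M.iso.inv)
  obtain ⟨z, hz⟩ := IsLiftObstruction.exists_of.{w} h (F.map u)
  obtain rfl := hz.eq_zero_of_map h
  rw [hu] at hz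
  have h₁ := ho.comp h hX' hoY
  have h₂ := hoX.comp h hX' hz
  rw [Iso.inv_hom_id_assoc, Ext.comp_zero, add_zero] at h₂
  have h₃ := congrArg (fun e => e.comp (Ext.mk₀ (M.iso.hom⟦(-1 : ℤ)⟧')) (add_zero 2))
    (h₁.eq h h₂)
  simp only [Ext.add_comp, Ext.comp_assoc_of_third_deg_zero, Ext.mk₀_comp_mk₀,
    ← Functor.map_comp, Iso.inv_hom_id, Category.assoc, Category.comp_id, hY₁,
    CategoryTheory.Functor.map_id, Ext.comp_mk₀_id] at h₃
  rw [h₃, Functor.map_comp, ← Ext.mk₀_comp_mk₀, ← Ext.comp_assoc_of_third_deg_zero, hX₁]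

lemma IsObstructionClass.compatible_map {X Y : T}
    {dX : Ext.{w} (F.obj X) ((F.obj X)⟦(-1 : ℤ)⟧) 2}
    {dY : Ext.{w} (F.obj Y) ((F.obj Y)⟦(-1 : ℤ)⟧) 2}
    (hX : IsObstructionClass J F dec X dX) (hY : IsObstructionClass J F dec Y dY) (u : X ⟶ Y) :
    Compatible dX dY (F.map u) := by
  obtain ⟨o, ho⟩ := IsLiftObstruction.exists_of.{w} h (F.map u)
  have := hX.liftObstruction_add h hdim hY ho
  rwa [ho.eq_zero_of_map h, zero_add] at this

lemma IsObstructionClass.eq {X : T} {d d' : Ext.{w} (F.obj X) ((F.obj X)⟦(-1 : ℤ)⟧) 2}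
    (hd : IsObstructionClass J F dec X d) (hd' : IsObstructionClass J F dec X d') : d = d' := by
  have := hd.compatible_map h hdim hd' (𝟙 X)
  simp only [Compatible, CategoryTheory.Functor.map_id, Ext.mk₀_id_comp, Ext.comp_mk₀_id] at this
  exact this.symm

lemma IsObstructionClass.exists_lift {X Y : T}
    {dX : Ext.{w} (F.obj X) ((F.obj X)⟦(-1 : ℤ)⟧) 2}
    {dY : Ext.{w} (F.obj Y) ((F.obj Y)⟦(-1 : ℤ)⟧) 2}
    (hX : IsObstructionClass J F dec X dX) (hY : IsObstructionClass J F dec Y dY)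
    {q : F.obj X ⟶ F.obj Y} (hq : Compatible dX dY q) : ∃ u : X ⟶ Y, F.map u = q := by
  obtain ⟨o, ho⟩ := IsLiftObstruction.exists_of.{w} h q
  have := hX.liftObstruction_add h hdim hY ho
  rw [← hq, add_eq_right] at this
  subst this
  exact ho.exists_lift h hX.1

/-- Every class in `Ext²(M, M[-1])` is the obstruction class of a lifting of `M`. A canonical
lifting is the cone of some `φ : D ⟶ P`, and the lifting with the given class is the cone of
`φ + u` for a suitable `u` that `F` annihilates. -/
lemma exists_isObstructionClass_iso (M : A) (d : Ext.{w} M (M⟦(-1 : ℤ)⟧) 2) :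
    ∃ (X : T) (dX : Ext.{w} (F.obj X) ((F.obj X)⟦(-1 : ℤ)⟧) 2) (i : F.obj X ≅ M),
      IsOrth J X ∧ IsObstructionClass J F dec X dX ∧ Compatible dX d i.hom := by
  obtain ⟨L₁, hL₁⟩ := exists_isCanonical h hdim dec M
  obtain ⟨D, P, φ, π, κ, hc⟩ := h.exists_isCover L₁.obj
  have zero : F.map φ ≫ F.map π ≫ L₁.iso.hom = 0 := by
    rw [reassoc_of% hc.map_comp_map, zero_comp]
  have hS := hc.shortExact_of_iso L₁.iso rfl zero
  have hP := h.projective hc.isProj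
  have hD : IsOrth J D := hc.isOrth h L₁.orth
  have hD₂ : HasProjectiveDimensionLT (F.obj D) 2 := hc.hasProjectiveDimensionLT h 1
  have : HasProjectiveDimensionLT (F.obj P) 2 := hasProjectiveDimensionLT_of_ge _ 1 2 (by omega)
  let p : F.obj P ⟶ M := F.map π ≫ L₁.iso.hom
  have hp : Epi p := hS.epi_g
  -- Lift `d` along the surjections `Ext¹(F(D), F(P)[-1]) ⟶ Ext¹(F(D), M[-1]) ⟶ Ext²(M, M[-1])`.
  obtain ⟨z, hz⟩ := exists_extCls_comp_eq hS one_add_one_eq_two d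
  have hS' : (ShortComplex.mk (kernel.ι (p⟦(-1 : ℤ)⟧')) (p⟦(-1 : ℤ)⟧')
      (kernel.condition _)).ShortExact :=
    { exact := ShortComplex.exact_of_f_is_kernel _ (kernelIsKernel _) }
  obtain ⟨x, hx⟩ : ∃ x : Ext.{w} (F.obj D) ((F.obj P)⟦(-1 : ℤ)⟧) 1,
      x.comp (Ext.mk₀ (p⟦(-1 : ℤ)⟧')) (add_zero 1) = z :=
    Ext.covariant_sequence_exact₃ _ hS' z one_add_one_eq_two
      (Ext.eq_zero_of_hasProjectiveDimensionLT _ 2 le_rfl)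
  obtain ⟨u, hu⟩ := h.exists_of_ext hD x
  have hφ : F.map φ = F.map (φ + u) := by rw [F.map_add, hu.map_eq_zero, add_zero]
  have zero₂ : F.map (φ + u) ≫ p = 0 := by rw [← hφ, zero]
  have hS₂ : (ShortComplex.mk (F.map (φ + u)) p zero₂).ShortExact := by
    convert hS using 2
    exact hφ.symm
  obtain ⟨L₂, π₂, κ₂, hT₂, hp₂⟩ := h.exists_lifting_of_shortExact hD hc.isProj (φ + u) hS₂
  have hd : IsRelObstructionClass L₂ L₁ d := by
    refine ⟨P, D, p, φ, φ + u, π, κ, π₂, κ₂, hc.isProj, hc.dist, hT₂, rfl, hp₂, hφ, zero, hS, x,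
      by rwa [add_sub_cancel_left], ?_⟩
    rw [hx]
    exact hz.symm
  obtain ⟨o, ho⟩ := IsLiftObstruction.exists_of.{w} h (L₂.iso.hom ≫ L₁.iso.inv)
  obtain ⟨dX, hdX⟩ := exists_isRelObstructionClass.{w} h ⟨L₂.obj, L₂.orth, Iso.refl _⟩
    ⟨L₁.obj, L₁.orth, L₁.iso ≪≫ L₂.iso.symm⟩
  refine ⟨L₂.obj, dX, L₂.iso, L₂.orth, ⟨L₂.orth, _, hL₁.of_iso L₂.iso.symm, hdX⟩, ?_⟩
  have h₁ := hd.comp_eq h ho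
  have h₂ : o.comp (Ext.mk₀ ((L₁.iso.hom ≫ L₂.iso.inv)⟦(-1 : ℤ)⟧')) (add_zero 2) = dX :=
    (hdX.comp_eq h (by simpa using ho)).trans (Ext.mk₀_id_comp dX)
  rw [Compatible, ← h₁, ← h₂, Ext.comp_assoc_of_third_deg_zero, Ext.mk₀_comp_mk₀,
    ← Functor.map_comp, Category.assoc, Iso.inv_hom_id, Category.comp_id]

end Classification

end ExtEnriched

open ExtEnriched

theorem mainTheorem2
    {T : Type u} [Category.{v} T] [HasZeroObject T] [HasShift T ℤ] [Preadditive T]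
    [∀ n : ℤ, (shiftFunctor T n).Additive] [Pretriangulated T] [IsTriangulated T]
    [HasCountableCoproducts T]
    {A : Type u'} [Category.{v'} A] [Abelian A] [HasShift A ℤ]
    [∀ n : ℤ, (shiftFunctor A n).Additive] [HasExt.{w} A]
    (J : MorphismProperty T)
    (hJ : ExtEnriched.IsStableHomologicalIdeal.{w₁, w₂} J)
    (hJsum : ExtEnriched.CompatibleWithCountableSums J)
    (hJproj : ExtEnriched.EnoughProj J)
    (F : T ⥤ A) [F.CommShift ℤ] [F.IsHomological]
    (hF : ExtEnriched.IsUniversal.{max u v u' v'} J F)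
    (dec : ExtEnriched.EvenDecomposition A)
    (hdim : ∀ M : A, HasProjectiveDimensionLE M 2) :
    ∃ (δ : ∀ X : (ExtEnriched.Loc J).FullSubcategory,
          Ext.{w} (F.obj X.obj) ((F.obj X.obj)⟦(-1 : ℤ)⟧) 2)
      (hδ : ∀ (X Y : (ExtEnriched.Loc J).FullSubcategory) (f : X ⟶ Y),
          ExtEnriched.Compatible (δ X) (δ Y) (((ExtEnriched.Loc J).ι ⋙ F).map f)),
      (∀ X e, ExtEnriched.IsObstructionClass J F dec X.obj e ↔ e = δ X) ∧
      (ExtEnriched.pairFunctor (ExtEnriched.Loc J) F δ hδ).Full ∧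
      Function.Bijective
        (ExtEnriched.isoClassMap (ExtEnriched.pairFunctor (ExtEnriched.Loc J) F δ hδ)) ∧
      (∀ (X Y : (ExtEnriched.Loc J).FullSubcategory) (f : X ⟶ Y),
        IsIso ((ExtEnriched.pairFunctor (ExtEnriched.Loc J) F δ hδ).map f) → IsIso f) := by
  have h := hF.isProjectiveApproximation hJ hJproj
  have hLoc (X : T) : Loc J X ↔ IsOrth J X := h.loc_iff_isOrth 2 hdim
  choose δ hδ using fun X : (Loc J).FullSubcategory =>
    exists_isObstructionClass.{w} (dec := dec) h hdim ((hLoc _).1 X.property)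
  have hcomp (X Y : (Loc J).FullSubcategory) (f : X ⟶ Y) :
      Compatible (δ X) (δ Y) (((Loc J).ι ⋙ F).map f) :=
    (hδ X).compatible_map h hdim (hδ Y) f.hom
  have hfull (X Y : (Loc J).FullSubcategory)
      (f : (pairFunctor (Loc J) F δ hcomp).obj X ⟶ (pairFunctor (Loc J) F δ hcomp).obj Y) :
      ∃ u : X ⟶ Y, (pairFunctor (Loc J) F δ hcomp).map u = f := by
    obtain ⟨u, hu⟩ := (hδ X).exists_lift h hdim (hδ Y) f.compatible
    exact ⟨ObjectProperty.homMk u, Pairs.Hom.ext hu⟩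
  have hconservative (X Y : (Loc J).FullSubcategory) (f : X ⟶ Y)
      (hf : IsIso ((pairFunctor (Loc J) F δ hcomp).map f)) : IsIso f := by
    obtain ⟨g, hg₁, hg₂⟩ := hf
    have : IsIso (F.map f.hom) :=
      ⟨g.hom, congrArg Pairs.Hom.hom hg₁, congrArg Pairs.Hom.hom hg₂⟩
    have : IsIso ((Loc J).ι.map f) :=
      h.isIso_of_isIso_map ((hLoc _).1 X.property) ((hLoc _).1 Y.property) f.hom
    exact isIso_of_fully_faithful (Loc J).ι f
  refine ⟨δ, hcomp, fun X e => ⟨fun he => he.eq h hdim (hδ X), ?_⟩, ⟨fun {X Y} => hfull X Y⟩,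
    ⟨?_, ?_⟩, hconservative⟩
  · rintro rfl
    exact hδ X
  · rintro ⟨X⟩ ⟨Y⟩ hXY
    obtain ⟨i⟩ := Quotient.exact hXY
    obtain ⟨u, hu⟩ := hfull X Y i.hom
    have := hconservative X Y u (by rw [hu]; infer_instance)
    exact Quotient.sound ⟨asIso u⟩
  · rintro ⟨M⟩
    obtain ⟨X, d, i, hX, hd, hi⟩ := exists_isObstructionClass_iso (dec := dec) h hdim M.obj M.cls
    let X' : (Loc J).FullSubcategory := ⟨X, (hLoc X).2 hX⟩
    obtain rfl : d = δ X' := hd.eq h hdim (hδ X')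
    -- The inverse of `i` is compatible with the classes as well.
    have hi' : Compatible M.cls (δ X') i.inv := by
      have h₁ : (Ext.mk₀ i.hom).comp M.cls (zero_add 2) =
          (δ X').comp (Ext.mk₀ (i.hom⟦(-1 : ℤ)⟧')) (add_zero 2) := hi
      refine mk₀_comp_injective_of_isIso i.hom
        (comp_mk₀_injective_of_isIso (i.hom⟦(-1 : ℤ)⟧') ?_)
      rw [Ext.mk₀_comp_mk₀_assoc, Iso.hom_inv_id, Ext.mk₀_id_comp, ← h₁,
        Ext.comp_assoc_of_third_deg_zero, Ext.comp_assoc_of_third_deg_zero, Ext.mk₀_comp_mk₀,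
        ← Functor.map_comp, Iso.inv_hom_id, CategoryTheory.Functor.map_id, Ext.comp_mk₀_id]
    exact ⟨Quotient.mk _ X', Quotient.sound ⟨⟨⟨i.hom, hi⟩, ⟨i.inv, hi'⟩,
      Pairs.Hom.ext i.hom_inv_id, Pairs.Hom.ext i.inv_hom_id⟩⟩⟩
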